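/- \textbf{Setting.} Let $\mathcal S$ be a finite set of states with a probability distribution $P_S$, and let $\mathcal A=\{1,\dots,K\}$, $K\ge 1$, be the set of actions. For each pair $(s,a)$ there is an unknown parameter $\vartheta_{s,a}$ in a measurable space $\Theta$; the parameters are independent, $\vartheta_{s,a}$ having an arbitrary prior law $p_1^{s,a}$. Given $\vartheta_{s,a}=\vartheta$, the reward of action $a$ in state $s$ is a real random variable with law $P_{s,a,\vartheta}$, which has a jointly measurable density $f_{s,a}(\vartheta,\cdot)$ with respect to a fixed $\sigma$-finite measure on $\mathbb R$ (for example, a canonical exponential family). Let $m_{s,a}(\vartheta)$ be the mean of $P_{s,a,\vartheta}$, and put $\mu(s,a)=m_{s,a}(\vartheta_{s,a})$. Rewards are normalized: for all $s,a,\vartheta$, $m_{s,a}(\vartheta)\in[0,1]$, and under $P_{s,a,\vartheta}$ the centred reward $r-m_{s,a}(\vartheta)$ is sub-Gaussian with variance proxy $1$, i.e. $\mathbb E\, e^{\lambda (r-m_{s,a}(\vartheta))}\le e^{\lambda^2/2}$ for all $\lambda\in\mathbb R$. In each round $h=1,\dots,H$, each of $N\ge 1$ agents $n$ gets a state $s_h^n\sim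 P_S$, independently across rounds and agents. The action $A_h^n$ is drawn from $\pi_h(\cdot\mid s_h^n)$, and a reward $r_h^n$ is drawn from the reward law of $(s_h^n,A_h^n)$. Given the parameters and the history of rounds $1,\dots,h-1$, the triples $(s_h^n,A_h^n,r_h^n)$, $n=1,\dots,N$, are independent and use the same policy $\pi_h$. The policy is that of Thompson sampling with one instance per state: $p_h^{s,a}$ is the posterior law of $\vartheta_{s,a}$ obtained by Bayes' rule from the prior $p_1^{s,a}$ and the rewards that all the agents received for action $a$ in state $s$ during rounds $1,\dots,h-1$; to act in state $s$, one draws $\hat\vartheta_a\sim p_h^{s,a}$ independently for $a\in\mathcal A$ and takes an action maximizing $m_{s,a}(\hat\vartheta_a)$, ties being broken by a fixed measurable rule. Thus the policy is updated only once per round. Let $a^*(s)$ be a maximizer of $a\mapsto\mu(s,a)$, let $T=NH$, and define the Bayesian system regret $$\mathrm{BR}(\pi,T)=\mathbb E\Big[\sum_{h=1}^H\sum_{n=1}^N \mu(s_h^n,a^*(s_h^n))-\mu(s_h^n,A_h^n)\Big],$$ the expectation being over parameters, states, actions and rewards. \textbf{Theorem (Bayesian system regret).} The expectation is well defined, and for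 every $H\ge 0$, with $T=NH$ (and $\log$ the natural logarithm), $$\mathrm{BR}(\pi,T)\le 2K|\mathcal S|N+4\sqrt{(2+6\log T)\,K N|\mathcal S|\,T}$$ (for $T=0$ the square root is read as $0$). Moreover, as $T\to\infty$, $\mathrm{BR}(\pi,T)\in\mathcal O\big(\sqrt{KT|\mathcal S|\log T}\big)$, with a constant that does not depend on $N$: there is a universal constant $C>0$ such that for all $K$, $N$ and $\mathcal S$ there is $T_0$, depending only on these, such that $\mathrm{BR}(\pi,T)\le C\sqrt{KT|\mathcal S|\log T}$ for every such bandit and all $T=NH\ge T_0$. -/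

import Mathlib

open MeasureTheory ProbabilityTheory

open scoped ENNReal

noncomputable section

namespace ContextualBandit

/-- A Bayesian contextual bandit with finite state set `S` and actions `Fin K`. Every pair `(s, a)`
has its own unknown parameter in `Θ`; the parameters are independent, with laws `prior s a`. Given
the parameter `ϑ`, a reward of action `a` in state `s` has density `density s a ϑ` with respect to
the reference measure `base s a` (for instance a canonical exponential family). -/
structure Model (S : Type*) [MeasurableSpace S] (K : ℕ) (Θ : Type*) [MeasurableSpace Θ] where
  /-- The law of the states. -/
  stateLaw : Measure S
  stateLaw_prob : IsProbabilityMeasure stateLaw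
  /-- The reference measure of the reward densities. -/
  base : S → Fin K → Measure ℝ
  base_sigmaFinite : ∀ s a, SigmaFinite (base s a)
  /-- The reward densities. -/
  density : S → Fin K → Θ → ℝ → ℝ≥0∞
  measurable_density : ∀ s a, Measurable (Function.uncurry (density s a))
  reward_prob : ∀ s a ϑ, IsProbabilityMeasure ((base s a).withDensity (density s a ϑ))
  /-- The prior law of the parameter of a pair of a state and an action. -/
  prior : S → Fin K → Measure Θ
  prior_prob : ∀ s a, IsProbabilityMeasure (prior s a)

attribute [instance] Model.stateLaw_prob Model.base_sigmaFinite Model.reward_prob Model.prior_prob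

/-- A measurable way to choose a maximizer of a vector indexed by the actions. -/
structure ArgmaxRule (K : ℕ) where
  /-- The chosen maximizer. -/
  select : (Fin K → ℝ) → Fin K
  measurable_select : Measurable select
  le_select : ∀ (v : Fin K → ℝ) (a : Fin K), v a ≤ v (select v)

/-- What is recorded of one agent in one round: state, action and reward. -/
abbrev Obs (S : Type*) (K : ℕ) : Type _ := S × Fin K × ℝ

/-- The records of all `N` agents in the first `h` rounds. -/
abbrev History (S : Type*) (K N h : ℕ) : Type _ := Fin h → Fin N → Obs S K

/-- A value of all the unknown parameters. -/
abbrev Params (S : Type*) (K : ℕ) (Θ : Type*) : Type _ := S → Fin K → Θ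

namespace Model

variable {S : Type*} [MeasurableSpace S] {K : ℕ} {Θ : Type*} [MeasurableSpace Θ]

/-- The law of a reward of action `a` in state `s` at parameter `ϑ`. -/
def rewardLaw (M : Model S K Θ) (s : S) (a : Fin K) (ϑ : Θ) : Measure ℝ :=
  (M.base s a).withDensity (M.density s a ϑ)

/-- The mean reward of action `a` in state `s` at parameter `ϑ`. -/
def mean (M : Model S K Θ) (s : S) (a : Fin K) (ϑ : Θ) : ℝ :=
  ∫ r, r ∂(M.rewardLaw s a ϑ)

/-- The normalization of the rewards: mean rewards lie in `[0, 1]`, and the noise is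
sub-Gaussian with variance proxy `1`. -/
structure IsNormalized (M : Model S K Θ) : Prop where
  mean_mem : ∀ s a ϑ, M.mean s a ϑ ∈ Set.Icc (0 : ℝ) 1
  subgaussian : ∀ s a ϑ,
    HasSubgaussianMGF (fun r => r - M.mean s a ϑ) 1 (M.rewardLaw s a ϑ)

instance (M : Model S K Θ) (s : S) (a : Fin K) (ϑ : Θ) :
    IsProbabilityMeasure (M.rewardLaw s a ϑ) :=
  M.reward_prob s a ϑ

lemma measurable_rewardLaw (M : Model S K Θ) (s : S) (a : Fin K) :
    Measurable (M.rewardLaw s a) := by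
  refine Measure.measurable_of_measurable_coe _ fun t ht => ?_
  simp only [rewardLaw, withDensity_apply _ ht]
  exact (M.measurable_density s a).lintegral_prod_right'

lemma measurable_mean (M : Model S K Θ) (s : S) (a : Fin K) : Measurable (M.mean s a) := by
  let κ : Kernel Θ ℝ := ⟨M.rewardLaw s a, M.measurable_rewardLaw s a⟩
  have : IsMarkovKernel κ := ⟨fun ϑ => M.reward_prob s a ϑ⟩
  have h : StronglyMeasurable fun ϑ => ∫ r, r ∂(κ ϑ) :=
    StronglyMeasurable.integral_kernel_prod_right' (f := fun p : Θ × ℝ => p.2)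
      measurable_snd.stronglyMeasurable
  exact h.measurable

variable {N h : ℕ}

open Classical in
/-- The likelihood of the parameter `ϑ` of the pair `(s, a)`: the product of the densities of the
rewards that were obtained with action `a` in state `s`. -/
def likelihood (M : Model S K Θ) (s : S) (a : Fin K) (H : History S K N h) (ϑ : Θ) : ℝ≥0∞ :=
  ∏ l, ∏ n, if (H l n).1 = s ∧ (H l n).2.1 = a then M.density s a ϑ (H l n).2.2 else 1

/-- The normalizing constant of Bayes' rule. -/
def evidence (M : Model S K Θ) (s : S) (a : Fin K) (H : History S K N h) : ℝ≥0∞ :=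
  ∫⁻ ϑ, M.likelihood s a H ϑ ∂(M.prior s a)

open Classical in
/-- The belief on the parameter of the pair `(s, a)` after the history `H`: the posterior law given
by Bayes' rule. (On the exceptional histories where Bayes' rule cannot be normalized, which occur
with probability zero, it is set to the prior.) -/
def beliefLaw (M : Model S K Θ) (s : S) (a : Fin K) (H : History S K N h) : Measure Θ :=
  if M.evidence s a H = 0 ∨ M.evidence s a H = ∞ then M.prior s a
  else (M.evidence s a H)⁻¹ • (M.prior s a).withDensity (M.likelihood s a H)

/-- The law of the action that Thompson sampling takes in state `s` after the history `H`: draw one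
parameter for every action, independently, from the current beliefs of the instance of state `s`,
and take the action with the largest sampled mean. -/
def policyLaw (M : Model S K Θ) (ρ : ArgmaxRule K) (H : History S K N h) (s : S) :
    Measure (Fin K) :=
  (Measure.pi fun a => M.beliefLaw s a H).map fun v => ρ.select fun a => M.mean s a (v a)

instance isProbabilityMeasure_beliefLaw (M : Model S K Θ) (s : S) (a : Fin K)
    (H : History S K N h) : IsProbabilityMeasure (M.beliefLaw s a H) := by
  unfold beliefLaw
  split_ifs with hc
  · infer_instance
  · push Not at hc
    refine ⟨?_⟩
    rw [Measure.smul_apply, withDensity_apply _ MeasurableSet.univ, Measure.restrict_univ,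
      smul_eq_mul]
    exact ENNReal.inv_mul_cancel hc.1 hc.2

lemma measurable_sampledAction (M : Model S K Θ) (ρ : ArgmaxRule K) (s : S) :
    Measurable fun v : Fin K → Θ => ρ.select fun a => M.mean s a (v a) :=
  ρ.measurable_select.comp
    (measurable_pi_lambda _ fun a => (M.measurable_mean s a).comp (measurable_pi_apply a))

instance isProbabilityMeasure_policyLaw (M : Model S K Θ) (ρ : ArgmaxRule K)
    (H : History S K N h) (s : S) : IsProbabilityMeasure (M.policyLaw ρ H s) :=
  Measure.isProbabilityMeasure_map (M.measurable_sampledAction ρ s).aemeasurable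

lemma measurable_measure_pi {X ι : Type*} [MeasurableSpace X] [Fintype ι] {β : ι → Type*}
    [∀ i, MeasurableSpace (β i)] (κ : ∀ i, X → Measure (β i))
    (hp : ∀ i x, IsProbabilityMeasure (κ i x)) (hκ : ∀ i, Measurable (κ i)) :
    Measurable fun x => Measure.pi fun i => κ i x := by
  refine Measurable.measure_of_isPiSystem_of_isProbabilityMeasure generateFrom_pi.symm
    isPiSystem_pi ?_
  rintro _ ⟨t, ht, rfl⟩
  simp only [Measure.pi_pi]
  exact Finset.measurable_prod _ fun i _ =>
    (Measure.measurable_coe (ht i (Set.mem_univ i))).comp (hκ i)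

variable [MeasurableSingletonClass S]

lemma measurable_likelihood (M : Model S K Θ) (s : S) (a : Fin K) :
    Measurable fun p : History S K N h × Θ => M.likelihood s a p.1 p.2 := by
  unfold likelihood
  refine Finset.measurable_prod _ fun l _ => Finset.measurable_prod _ fun n _ => ?_
  have hm : Measurable fun p : History S K N h × Θ => p.1 l n := by fun_prop
  refine Measurable.ite ?_ ?_ measurable_const
  · exact ((measurableSet_singleton s).preimage hm.fst).inter
      ((measurableSet_singleton a).preimage hm.snd.fst)
  · exact (M.measurable_density s a).comp (measurable_snd.prodMk hm.snd.snd)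

lemma measurable_beliefLaw (M : Model S K Θ) (s : S) (a : Fin K) :
    Measurable fun H : History S K N h => M.beliefLaw s a H := by
  have hE : Measurable fun H : History S K N h => M.evidence s a H :=
    (M.measurable_likelihood s a).lintegral_prod_right'
  unfold beliefLaw
  refine Measurable.ite ?_ measurable_const ?_
  · exact ((measurableSet_singleton 0).preimage hE).union
      ((measurableSet_singleton ∞).preimage hE)
  · refine Measure.measurable_of_measurable_coe _ fun t ht => ?_
    simp only [Measure.smul_apply, withDensity_apply _ ht, smul_eq_mul]
    exact hE.inv.mul (M.measurable_likelihood s a).lintegral_prod_right'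

variable [Fintype S]

/-- `policyLaw` as a probability kernel. -/
def policy (M : Model S K Θ) (ρ : ArgmaxRule K) (N h : ℕ) :
    Kernel (History S K N h × S) (Fin K) where
  toFun p := M.policyLaw ρ p.1 p.2
  measurable' := by
    refine measurable_from_prod_countable_left fun s => ?_
    exact (Measure.measurable_map _ (M.measurable_sampledAction ρ s)).comp
      (measurable_measure_pi _ (fun a H => inferInstance) fun a => M.measurable_beliefLaw s a)

/-- `rewardLaw` as a probability kernel. -/
def reward (M : Model S K Θ) : Kernel (Params S K Θ × S × Fin K) ℝ where
  toFun p := M.rewardLaw p.2.1 p.2.2 (p.1 p.2.1 p.2.2)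
  measurable' := by
    refine measurable_from_prod_countable_left fun q => ?_
    exact (M.measurable_rewardLaw q.1 q.2).comp
      ((measurable_pi_apply q.2).comp (measurable_pi_apply q.1))

instance (M : Model S K Θ) (ρ : ArgmaxRule K) : IsMarkovKernel (M.policy ρ N h) :=
  ⟨fun p => inferInstanceAs (IsProbabilityMeasure (M.policyLaw ρ p.1 p.2))⟩

instance (M : Model S K Θ) : IsMarkovKernel M.reward :=
  ⟨fun p => inferInstanceAs
    (IsProbabilityMeasure (M.rewardLaw p.2.1 p.2.2 (p.1 p.2.1 p.2.2)))⟩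

/-- The law of the record of one agent in round `h + 1`, given the parameters and the history of the
first `h` rounds: the state has law `stateLaw`, the action is drawn from the policy computed from
that history, and then the reward is drawn. -/
def agent (M : Model S K Θ) (ρ : ArgmaxRule K) (N h : ℕ) :
    Kernel (Params S K Θ × History S K N h) (Obs S K) :=
  Kernel.const _ M.stateLaw ⊗ₖ
    ((M.policy ρ N h).comap
        (fun x : (Params S K Θ × History S K N h) × S => (x.1.2, x.2)) (by fun_prop) ⊗ₖ
      M.reward.comap
        (fun x : ((Params S K Θ × History S K N h) × S) × Fin K => (x.1.1.1, x.1.2, x.2))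
        (by fun_prop))

instance (M : Model S K Θ) (ρ : ArgmaxRule K) : IsMarkovKernel (M.agent ρ N h) := by
  unfold agent; infer_instance

/-- The law of round `h + 1`: given the parameters and the history of the first `h` rounds, the `N`
agents are independent and use the same policy. -/
def round (M : Model S K Θ) (ρ : ArgmaxRule K) (N h : ℕ) :
    Kernel (Params S K Θ × History S K N h) (Fin N → Obs S K) where
  toFun x := Measure.pi fun _ => M.agent ρ N h x
  measurable' := measurable_measure_pi _ (fun _ _ => inferInstance)
    fun _ => (M.agent ρ N h).measurable

/-- The joint law of the parameters and of the history of the first `h` rounds when `N` agents run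
Thompson sampling, the policy being updated at the end of every round. -/
def run (M : Model S K Θ) (ρ : ArgmaxRule K) (N : ℕ) :
    (h : ℕ) → Measure (Params S K Θ × History S K N h)
  | 0 => (Measure.pi fun s => Measure.pi fun a => M.prior s a).map fun θ => (θ, Fin.elim0)
  | h + 1 => (M.run ρ N h ⊗ₘ M.round ρ N h).map fun x => (x.1.1, Fin.snoc x.1.2 x.2)

instance (M : Model S K Θ) (ρ : ArgmaxRule K) : IsMarkovKernel (M.round ρ N h) :=
  ⟨fun x => inferInstanceAs (IsProbabilityMeasure (Measure.pi fun _ => M.agent ρ N h x))⟩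

instance isProbabilityMeasure_run (M : Model S K Θ) (ρ : ArgmaxRule K) :
    IsProbabilityMeasure (M.run ρ N h) := by
  induction h with
  | zero => exact Measure.isProbabilityMeasure_map (by fun_prop)
  | succ h ih =>
    refine Measure.isProbabilityMeasure_map (Measurable.aemeasurable ?_)
    refine measurable_fst.fst.prodMk (measurable_pi_lambda _ fun l => ?_)
    refine Fin.lastCases ?_ (fun i => ?_) l
    · simpa only [Fin.snoc_last] using measurable_snd
    · simp only [Fin.snoc_castSucc]
      fun_prop

/-- The regret collected in `h` rounds: the sum, over rounds and agents, of the gaps between the mean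
reward of the optimal action and of the action taken in the agent's state. -/
def regret (M : Model S K Θ) (ρ : ArgmaxRule K) {N h : ℕ}
    (x : Params S K Θ × History S K N h) : ℝ :=
  ∑ l, ∑ n, (M.mean (x.2 l n).1 (ρ.select fun a => M.mean (x.2 l n).1 a (x.1 (x.2 l n).1 a))
        (x.1 (x.2 l n).1 (ρ.select fun a => M.mean (x.2 l n).1 a (x.1 (x.2 l n).1 a)))
      - M.mean (x.2 l n).1 (x.2 l n).2.1 (x.1 (x.2 l n).1 (x.2 l n).2.1))

/-- The Bayesian system regret of Thompson sampling with `N` agents and `H` rounds. -/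
def bayesRegret (M : Model S K Θ) (ρ : ArgmaxRule K) (N H : ℕ) : ℝ :=
  ∫ x, M.regret ρ x ∂(M.run ρ N H)

end Model

end ContextualBandit

end

/-! Posterior sampling lets a confidence bound be compared with itself. Given the history and the
state, the action of Thompson sampling and the optimal action have the same law, so an upper bound
U(s, a) computed from the history has the same expectation at both
(`lintegral_agent_eq_lintegral_optimal`, `integral_upper_eq`). In expectation the gap therefore
splits into μ - U at the optimal action plus U - μ at the action taken. Where the confidence bounds
hold, the first part is at most 0 and the second at most `width` (`gap_le`). The policy never sees
U, so its level β may depend on the horizon.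

The equality of laws is Bayes' rule. The policy depends on the history alone, so the parameters
enter the joint law only through the reward densities, and the likelihood factors over pairs (s, a).
The posterior is thus the product of the beliefs that the policy samples from
(`exists_run_eq_likelihood`, `lintegral_run_eq_lintegral_belief`).

Failures of the bounds are controlled by an exponential supermartingale, Markov's inequality and a
union bound over the number of pulls (`measure_deviation_le`). With β = 2 + 6 log T they cost at
most K|S|N in total.

The widths use counts frozen during a round. The first N pulls of each pair are charged 1 each;
afterwards √(n - N) serves as a potential that telescopes (`mul_width_le`). Stale counts thus cost
an additive N per pair and no factor in the leading term. Cauchy–Schwarz over the K|S| pairs, whose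
pulls add up to T, gives `bayesRegret_le`, and both claims follow from it. -/

noncomputable section

namespace ContextualBandit

/-! ### Densities of product measures. -/

section ProductMeasures

variable {ι : Type*} [Fintype ι] {Ω : ι → Type*} [∀ i, MeasurableSpace (Ω i)]
  (μ : ∀ i, Measure (Ω i)) [∀ i, IsProbabilityMeasure (μ i)] {f : ∀ i, Ω i → ℝ≥0∞}

theorem lintegral_pi_prod (hf : ∀ i, Measurable (f i)) :
    ∫⁻ x, ∏ i, f i (x i) ∂Measure.pi μ = ∏ i, ∫⁻ x, f i x ∂μ i := by
  have hi : iIndepFun (fun i (x : ∀ i, Ω i) => f i (x i)) (Measure.pi μ) :=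
    iIndepFun_pi fun i => (hf i).aemeasurable
  refine (lintegral_prod_eq_prod_lintegral_of_indepFun Finset.univ _ hi
    fun i => (hf i).comp (measurable_pi_apply i)).trans ?_
  refine Finset.prod_congr rfl fun i _ => ?_
  exact (measurePreserving_eval μ i).lintegral_comp (hf i)

theorem pi_withDensity (hf : ∀ i, Measurable (f i))
    [∀ i, SigmaFinite ((μ i).withDensity (f i))] :
    Measure.pi (fun i => (μ i).withDensity (f i)) =
      (Measure.pi μ).withDensity fun x => ∏ i, f i (x i) := by
  refine Measure.pi_eq fun t ht => ?_
  rw [withDensity_apply _ (MeasurableSet.univ_pi ht), ← lintegral_indicator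
    (MeasurableSet.univ_pi ht)]
  have h : ∀ x : ∀ i, Ω i, (Set.univ.pi t).indicator (fun x => ∏ i, f i (x i)) x
      = ∏ i, (t i).indicator (f i) (x i) := fun x => by
    by_cases hx : x ∈ Set.univ.pi t
    · rw [Set.indicator_of_mem hx]
      exact Finset.prod_congr rfl fun i _ => (Set.indicator_of_mem (hx i (Set.mem_univ i)) _).symm
    · rw [Set.indicator_of_notMem hx]
      simp only [Set.mem_pi, Set.mem_univ, true_imp_iff, not_forall] at hx
      obtain ⟨i, hi⟩ := hx
      exact (Finset.prod_eq_zero (Finset.mem_univ i) (Set.indicator_of_notMem hi _)).symm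
  simp only [h]
  rw [lintegral_pi_prod μ fun i => (hf i).indicator (ht i)]
  refine Finset.prod_congr rfl fun i _ => ?_
  rw [withDensity_apply _ (ht i), lintegral_indicator (ht i)]

/-- Two applications of `pi_withDensity`, matching the two-level product over states and actions. -/
theorem pi_pi_withDensity {ι κ Ω : Type*} [Fintype ι] [Fintype κ] [MeasurableSpace Ω]
    (μ ν : ι → κ → Measure Ω) [∀ i j, IsProbabilityMeasure (μ i j)]
    [∀ i j, IsProbabilityMeasure (ν i j)] {f : ι → κ → Ω → ℝ≥0∞}
    (hf : ∀ i j, Measurable (f i j)) (hν : ∀ i j, ν i j = (μ i j).withDensity (f i j)) :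
    Measure.pi (fun i => Measure.pi (ν i)) = (Measure.pi fun i => Measure.pi (μ i)).withDensity
      fun x => ∏ i, ∏ j, f i j (x i j) := by
  have h1 : ∀ i j, IsProbabilityMeasure ((μ i j).withDensity (f i j)) := fun i j =>
    hν i j ▸ inferInstance
  have h2 : ∀ i, Measure.pi (ν i) =
      (Measure.pi (μ i)).withDensity fun x => ∏ j, f i j (x j) := fun i => by
    rw [← pi_withDensity _ (hf i)]
    exact congrArg _ (funext (hν i))
  have h3 : ∀ i, IsProbabilityMeasure
      ((Measure.pi (μ i)).withDensity fun x => ∏ j, f i j (x j)) := fun i =>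
    h2 i ▸ inferInstance
  simp only [h2]
  exact pi_withDensity (fun i => Measure.pi (μ i)) (f := fun i x => ∏ j, f i j (x j)) fun i =>
    Finset.measurable_prod _ fun j _ => (hf i j).comp (measurable_pi_apply j)

end ProductMeasures

/-! ### The joint law of parameters and history as a likelihood. -/

namespace Model

variable {S : Type*} [MeasurableSpace S] {K : ℕ} {Θ : Type*} [MeasurableSpace Θ] {N h : ℕ}

/-- Appending a round to a history is measurable. -/
@[fun_prop]
lemma measurable_snoc {X : Type*} [MeasurableSpace X] {f : X → History S K N h}
    {g : X → Fin N → Obs S K} (hf : Measurable f) (hg : Measurable g) :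
    Measurable fun x => (Fin.snoc (f x) (g x) : History S K N (h + 1)) := by
  refine measurable_pi_lambda _ fun l => ?_
  refine Fin.lastCases ?_ (fun i => ?_) l
  · simpa only [Fin.snoc_last] using hg
  · simp only [Fin.snoc_castSucc]
    fun_prop

/-- The joint prior law of all the parameters. -/
def jointPrior [Fintype S] (M : Model S K Θ) : Measure (Params S K Θ) :=
  Measure.pi fun s => Measure.pi fun a => M.prior s a

instance [Fintype S] (M : Model S K Θ) : IsProbabilityMeasure M.jointPrior := by
  unfold jointPrior; infer_instance

/-- The joint belief on all the parameters after the history `H`. -/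
def jointBelief [Fintype S] (M : Model S K Θ) (H : History S K N h) : Measure (Params S K Θ) :=
  Measure.pi fun s => Measure.pi fun a => M.beliefLaw s a H

instance [Fintype S] (M : Model S K Θ) (H : History S K N h) :
    IsProbabilityMeasure (M.jointBelief H) := by
  unfold jointBelief; infer_instance

/-- The likelihood of a value of all the parameters. -/
def jointLikelihood [Fintype S] (M : Model S K Θ) (H : History S K N h) (θ : Params S K Θ) :
    ℝ≥0∞ :=
  ∏ s, ∏ a, M.likelihood s a H (θ s a)

/-- The density of the reward in a record, seen as a function of the parameters. -/
def obsDensity (M : Model S K Θ) (θ : Params S K Θ) (y : Obs S K) : ℝ≥0∞ :=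
  M.density y.1 y.2.1 (θ y.1 y.2.1) y.2.2

lemma likelihood_snoc (M : Model S K Θ) (s : S) (a : Fin K) (H : History S K N h)
    (y : Fin N → Obs S K) (ϑ : Θ) :
    open Classical in
    M.likelihood s a (Fin.snoc H y : History S K N (h + 1)) ϑ = M.likelihood s a H ϑ *
      ∏ n, if (y n).1 = s ∧ (y n).2.1 = a then M.density s a ϑ (y n).2.2 else 1 := by
  classical
  unfold likelihood
  rw [Fin.prod_univ_castSucc]
  simp only [Fin.snoc_castSucc, Fin.snoc_last]

omit [MeasurableSpace S] in
lemma prod_prod_ite_eq [Fintype S] (s : S) (a : Fin K) (f : S → Fin K → ℝ≥0∞) :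
    open Classical in
    (∏ s', ∏ a', if s = s' ∧ a = a' then f s' a' else 1) = f s a := by
  classical
  rw [Finset.prod_eq_single s, Finset.prod_eq_single a] <;> simp +contextual
  · intro b hb
    simp [Ne.symm hb]
  · intro b hb
    simp [Ne.symm hb]

/-- Each new record contributes a nontrivial factor for exactly one pair, so the double product over
pairs collapses for every agent. -/
lemma jointLikelihood_snoc [Fintype S] (M : Model S K Θ) (H : History S K N h)
    (y : Fin N → Obs S K) (θ : Params S K Θ) :
    M.jointLikelihood (Fin.snoc H y : History S K N (h + 1)) θ =
      M.jointLikelihood H θ * ∏ n, M.obsDensity θ (y n) := by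
  classical
  unfold jointLikelihood obsDensity
  simp only [likelihood_snoc, Finset.prod_mul_distrib]
  congr 1
  rw [Finset.prod_congr rfl fun s _ => Finset.prod_comm, Finset.prod_comm]
  refine Finset.prod_congr rfl fun n _ => ?_
  exact prod_prod_ite_eq (y n).1 (y n).2.1 fun s a => M.density s a (θ s a) (y n).2.2

/-- A function of records is measurable once it is so for every state and action. -/
lemma measurable_of_obs [Countable S] [MeasurableSingletonClass S] {X Y : Type*}
    [MeasurableSpace X] [MeasurableSpace Y] {f : X × Obs S K → Y}
    (hf : ∀ s a, Measurable fun p : X × ℝ => f (p.1, s, a, p.2)) : Measurable f := by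
  have h : Measurable fun p : (X × ℝ) × S × Fin K => f (p.1.1, p.2.1, p.2.2, p.1.2) :=
    measurable_from_prod_countable_left fun q => hf q.1 q.2
  exact h.comp (((measurable_fst).prodMk measurable_snd.snd.snd).prodMk
    (measurable_snd.fst.prodMk measurable_snd.snd.fst))

lemma measurable_obsDensity [Countable S] [MeasurableSingletonClass S] (M : Model S K Θ) :
    Measurable fun p : Params S K Θ × Obs S K => M.obsDensity p.1 p.2 := by
  refine measurable_of_obs fun s a => ?_
  have hm : Measurable fun p : Params S K Θ × ℝ => (p.1 s a, p.2) := by fun_prop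
  exact (M.measurable_density s a).comp hm

/-- Needed for `toFinite` to be a probability measure. A prior forces `Θ` to be nonempty, and a zero
base measure carries no probability density. -/
lemma base_ne_zero (M : Model S K Θ) (s : S) (a : Fin K) : M.base s a ≠ 0 := by
  intro h0
  obtain ⟨ϑ⟩ := (M.prior s a).nonempty_of_neZero
  have := (M.reward_prob s a ϑ).measure_univ
  simp [h0] at this

instance (M : Model S K Θ) (s : S) (a : Fin K) : NeZero (M.base s a) := ⟨M.base_ne_zero s a⟩

attribute [local irreducible] likelihood

variable [MeasurableSingletonClass S]

lemma measurable_jointLikelihood [Fintype S] (M : Model S K Θ) :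
    Measurable fun p : History S K N h × Params S K Θ => M.jointLikelihood p.1 p.2 := by
  unfold jointLikelihood
  refine Finset.measurable_prod _ fun s _ => Finset.measurable_prod _ fun a _ => ?_
  have hm : Measurable fun p : History S K N h × Params S K Θ => (p.1, p.2 s a) := by fun_prop
  exact (M.measurable_likelihood s a).comp hm

attribute [local irreducible] jointLikelihood

lemma measurable_likelihood_right (M : Model S K Θ) (s : S) (a : Fin K) (H : History S K N h) :
    Measurable (M.likelihood s a H) :=
  (M.measurable_likelihood s a).comp (measurable_const.prodMk measurable_id)

variable [Fintype S]

/-- The probability kernel of reference measures of the rewards. -/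
def refReward (M : Model S K Θ) : Kernel (S × Fin K) ℝ where
  toFun q := (M.base q.1 q.2).toFinite
  measurable' := measurable_of_countable _

instance (M : Model S K Θ) : IsMarkovKernel M.refReward :=
  ⟨fun q => inferInstanceAs (IsProbabilityMeasure (M.base q.1 q.2).toFinite)⟩

/-- The law of a record when rewards have their reference laws. -/
def refAgent (M : Model S K Θ) (ρ : ArgmaxRule K) (N h : ℕ) :
    Kernel (History S K N h) (Obs S K) :=
  Kernel.const _ M.stateLaw ⊗ₖ (M.policy ρ N h ⊗ₖ
    M.refReward.comap (fun x : (History S K N h × S) × Fin K => (x.1.2, x.2)) (by fun_prop))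

instance (M : Model S K Θ) (ρ : ArgmaxRule K) : IsMarkovKernel (M.refAgent ρ N h) := by
  unfold refAgent; infer_instance

/-- The law of a round when rewards have their reference laws. -/
def refRound (M : Model S K Θ) (ρ : ArgmaxRule K) (N h : ℕ) :
    Kernel (History S K N h) (Fin N → Obs S K) where
  toFun H := Measure.pi fun _ => M.refAgent ρ N h H
  measurable' := measurable_measure_pi _ (fun _ _ => inferInstance)
    fun _ => (M.refAgent ρ N h).measurable

instance (M : Model S K Θ) (ρ : ArgmaxRule K) : IsMarkovKernel (M.refRound ρ N h) :=
  ⟨fun x => inferInstanceAs (IsProbabilityMeasure (Measure.pi fun _ => M.refAgent ρ N h x))⟩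

/-- The density of the original reference measure with respect to the normalized one. -/
def refWeight (M : Model S K Θ) (y : Obs S K) : ℝ≥0∞ :=
  (M.base y.1 y.2.1).rnDeriv (M.base y.1 y.2.1).toFinite y.2.2

lemma measurable_refWeight (M : Model S K Θ) : Measurable M.refWeight := by
  have h : Measurable fun p : ℝ × Obs S K => M.refWeight p.2 :=
    measurable_of_obs fun s a =>
      (Measure.measurable_rnDeriv (M.base s a) (M.base s a).toFinite).comp measurable_snd
  exact h.comp (measurable_const (a := (0 : ℝ)) |>.prodMk measurable_id)

lemma lintegral_agent (M : Model S K Θ) (ρ : ArgmaxRule K) (θ : Params S K Θ)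
    (H : History S K N h) {f : Obs S K → ℝ≥0∞} (hf : Measurable f) :
    ∫⁻ y, f y ∂(M.agent ρ N h (θ, H)) =
      ∫⁻ s, ∫⁻ a, ∫⁻ r, f (s, a, r) ∂(M.rewardLaw s a (θ s a)) ∂(M.policyLaw ρ H s)
        ∂M.stateLaw := by
  unfold agent
  rw [Kernel.lintegral_compProd _ _ _ hf]
  refine lintegral_congr fun s => ?_
  rw [Kernel.lintegral_compProd _ _ _ (f := fun c => f (s, c))
    (hf.comp (measurable_const.prodMk measurable_id))]
  rfl

lemma lintegral_refAgent (M : Model S K Θ) (ρ : ArgmaxRule K)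
    (H : History S K N h) {f : Obs S K → ℝ≥0∞} (hf : Measurable f) :
    ∫⁻ y, f y ∂(M.refAgent ρ N h H) =
      ∫⁻ s, ∫⁻ a, ∫⁻ r, f (s, a, r) ∂(M.base s a).toFinite ∂(M.policyLaw ρ H s)
        ∂M.stateLaw := by
  unfold refAgent
  rw [Kernel.lintegral_compProd _ _ _ hf]
  refine lintegral_congr fun s => ?_
  rw [Kernel.lintegral_compProd _ _ _ (f := fun c => f (s, c))
    (hf.comp (measurable_const.prodMk measurable_id))]
  rfl

/-- The state law and the policy do not involve `θ`, so only the reward changes its law. The weight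
corrects for replacing the σ-finite base measure by a probability measure, and `θ` is confined to
`obsDensity`. -/
lemma agent_eq_withDensity (M : Model S K Θ) (ρ : ArgmaxRule K) (θ : Params S K Θ)
    (H : History S K N h) :
    M.agent ρ N h (θ, H) =
      (M.refAgent ρ N h H).withDensity fun y => M.refWeight y * M.obsDensity θ y := by
  have hD : Measurable (M.obsDensity θ) :=
    M.measurable_obsDensity.comp (measurable_const.prodMk measurable_id)
  have hWD : Measurable fun y => M.refWeight y * M.obsDensity θ y :=
    M.measurable_refWeight.mul hD
  refine Measure.ext_of_lintegral _ fun f hf => ?_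
  rw [lintegral_withDensity_eq_lintegral_mul _ hWD hf,
    lintegral_agent M ρ θ H hf, lintegral_refAgent M ρ H (hWD.mul hf)]
  refine lintegral_congr fun s => lintegral_congr fun a => ?_
  have hd : Measurable (M.density s a (θ s a)) :=
    (M.measurable_density s a).comp (measurable_const.prodMk measurable_id)
  have hfs : Measurable fun r => f (s, a, r) :=
    hf.comp (measurable_const.prodMk (measurable_const.prodMk measurable_id))
  have hb : (M.base s a).toFinite.withDensity ((M.base s a).rnDeriv (M.base s a).toFinite)
      = M.base s a := Measure.withDensity_rnDeriv_eq _ _ (absolutelyContinuous_toFinite _)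
  unfold rewardLaw
  rw [lintegral_withDensity_eq_lintegral_mul _ hd hfs]
  conv_lhs => rw [← hb]
  rw [lintegral_withDensity_eq_lintegral_mul _ (Measure.measurable_rnDeriv _ _) (hd.mul hfs)]
  refine lintegral_congr fun r => ?_
  simp [refWeight, obsDensity, mul_assoc]

lemma round_eq_withDensity (M : Model S K Θ) (ρ : ArgmaxRule K) (θ : Params S K Θ)
    (H : History S K N h) :
    M.round ρ N h (θ, H) = (M.refRound ρ N h H).withDensity
      fun y => (∏ n, M.refWeight (y n)) * ∏ n, M.obsDensity θ (y n) := by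
  have hD : Measurable (M.obsDensity θ) :=
    M.measurable_obsDensity.comp (measurable_const.prodMk measurable_id)
  have hp : IsProbabilityMeasure
      ((M.refAgent ρ N h H).withDensity fun y => M.refWeight y * M.obsDensity θ y) := by
    rw [← agent_eq_withDensity]; infer_instance
  change Measure.pi (fun _ => M.agent ρ N h (θ, H)) = (Measure.pi _).withDensity _
  simp only [agent_eq_withDensity, ← Finset.prod_mul_distrib]
  exact pi_withDensity _ fun _ => M.measurable_refWeight.mul hD

lemma lintegral_run_succ (M : Model S K Θ) (ρ : ArgmaxRule K)
    {f : Params S K Θ × History S K N (h + 1) → ℝ≥0∞} (hf : Measurable f) :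
    ∫⁻ x, f x ∂(M.run ρ N (h + 1)) =
      ∫⁻ x, ∫⁻ y, f (x.1, Fin.snoc x.2 y) ∂(M.round ρ N h x) ∂(M.run ρ N h) := by
  have hm : Measurable fun x : (Params S K Θ × History S K N h) × (Fin N → Obs S K) =>
      ((x.1.1, Fin.snoc x.1.2 x.2) : Params S K Θ × History S K N (h + 1)) := by fun_prop
  change ∫⁻ x, f x ∂((M.run ρ N h ⊗ₘ M.round ρ N h).map _) = _
  rw [lintegral_map hf hm]
  exact Measure.lintegral_compProd (hf.comp hm)

/-- The joint law of parameters and history has the joint likelihood as a density. -/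
theorem exists_run_eq_likelihood (M : Model S K Θ) (ρ : ArgmaxRule K) :
    ∃ ν : Measure (History S K N h), SFinite ν ∧
      ∀ f : Params S K Θ × History S K N h → ℝ≥0∞, Measurable f →
        ∫⁻ x, f x ∂(M.run ρ N h) =
          ∫⁻ H, ∫⁻ θ, f (θ, H) * M.jointLikelihood H θ ∂M.jointPrior ∂ν := by
  induction h with
  | zero =>
    refine ⟨Measure.dirac Fin.elim0, inferInstance, fun f hf => ?_⟩
    have hm : Measurable fun θ : Params S K Θ =>
      ((θ, Fin.elim0) : Params S K Θ × History S K N 0) := by fun_prop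
    change ∫⁻ x, f x ∂(M.jointPrior.map _) = _
    rw [lintegral_map hf hm, lintegral_dirac']
    · simp [jointLikelihood, likelihood]
    · exact ((hf.comp measurable_swap).mul M.measurable_jointLikelihood).lintegral_prod_right'
  | succ h ih =>
    obtain ⟨ν, hν, ih⟩ := ih
    have hW : Measurable fun y : Fin N → Obs S K => ∏ n, M.refWeight (y n) :=
      Finset.measurable_prod _ fun n _ => M.measurable_refWeight.comp (measurable_pi_apply n)
    have hD : Measurable fun p : Params S K Θ × (Fin N → Obs S K) =>
        ∏ n, M.obsDensity p.1 (p.2 n) :=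
      Finset.measurable_prod _ fun n _ => M.measurable_obsDensity.comp
        (measurable_fst.prodMk ((measurable_pi_apply n).comp measurable_snd))
    have hsn : Measurable fun x : History S K N h × (Fin N → Obs S K) =>
        (Fin.snoc x.1 x.2 : History S K N (h + 1)) := by fun_prop
    -- The new history measure runs the same policy with reference rewards; everything free of `θ`
    -- is absorbed into it, and s-finiteness is kept for the next `⊗ₘ`.
    refine ⟨((ν ⊗ₘ M.refRound ρ N h).withDensity fun x => ∏ n, M.refWeight (x.2 n)).map
      fun x => Fin.snoc x.1 x.2, inferInstance, fun f hf => ?_⟩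
    have hg : Measurable fun H : History S K N (h + 1) =>
        ∫⁻ θ, f (θ, H) * M.jointLikelihood H θ ∂M.jointPrior :=
      ((hf.comp measurable_swap).mul M.measurable_jointLikelihood).lintegral_prod_right'
    have hx : Measurable fun q : (Params S K Θ × History S K N h) × (Fin N → Obs S K) =>
        f (q.1.1, Fin.snoc q.1.2 q.2) := hf.comp (by fun_prop)
    have hW2 : Measurable fun x : History S K N h × (Fin N → Obs S K) =>
        ∏ n, M.refWeight (x.2 n) := hW.comp measurable_snd
    have hg2 : Measurable fun x : History S K N h × (Fin N → Obs S K) =>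
        ∫⁻ θ, f (θ, Fin.snoc x.1 x.2) *
          M.jointLikelihood (Fin.snoc x.1 x.2 : History S K N (h + 1)) θ ∂M.jointPrior :=
      hg.comp hsn
    rw [lintegral_run_succ M ρ hf, ih _ hx.lintegral_kernel_prod_right', lintegral_map hg hsn,
      lintegral_withDensity_eq_lintegral_mul _ hW2 hg2,
      Measure.lintegral_compProd (hW2.mul hg2)]
    refine lintegral_congr fun H => ?_
    have hf' : Measurable fun q : Params S K Θ × (Fin N → Obs S K) =>
        f (q.1, Fin.snoc H q.2) := hf.comp (by fun_prop)
    have hΛ : Measurable fun θ => M.jointLikelihood H θ :=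
      M.measurable_jointLikelihood.comp (measurable_const.prodMk measurable_id)
    have hΛ' : Measurable fun q : Params S K Θ × (Fin N → Obs S K) =>
        M.jointLikelihood (Fin.snoc H q.2 : History S K N (h + 1)) q.1 := by
      have hm : Measurable fun q : Params S K Θ × (Fin N → Obs S K) =>
          ((Fin.snoc H q.2 : History S K N (h + 1)), q.1) := by fun_prop
      exact M.measurable_jointLikelihood.comp hm
    -- For fixed `θ`, the density of the round multiplies the old likelihood into the new one.
    have hin : ∀ θ, (∫⁻ y, f (θ, Fin.snoc H y) ∂(M.round ρ N h (θ, H))) * M.jointLikelihood H θ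
        = ∫⁻ y, (∏ n, M.refWeight (y n)) * (f (θ, Fin.snoc H y) *
            M.jointLikelihood (Fin.snoc H y : History S K N (h + 1)) θ)
          ∂(M.refRound ρ N h H) := fun θ => by
      have h1 : Measurable fun y : Fin N → Obs S K => ∏ n, M.obsDensity θ (y n) :=
        hD.comp (measurable_const.prodMk measurable_id)
      have h2 : Measurable fun y : Fin N → Obs S K => f (θ, Fin.snoc H y) :=
        hf'.comp (measurable_const.prodMk measurable_id)
      have h3 : Measurable fun y : Fin N → Obs S K =>
          (∏ n, M.refWeight (y n)) * ∏ n, M.obsDensity θ (y n) := hW.mul h1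
      rw [round_eq_withDensity, lintegral_withDensity_eq_lintegral_mul _ h3 h2,
        ← lintegral_mul_const _ (h3.mul h2)]
      refine lintegral_congr fun y => ?_
      simp only [Pi.mul_apply, jointLikelihood_snoc]
      ring
    simp only [hin]
    rw [lintegral_lintegral_swap ((hW.comp measurable_snd).mul (hf'.mul hΛ')).aemeasurable]
    refine lintegral_congr fun y => ?_
    exact lintegral_const_mul _ ((hf'.mul hΛ').comp (measurable_id.prodMk measurable_const))

end Model

/-! ### Bayes' rule and the posterior sampling identity. -/

namespace Model

variable {S : Type*} [MeasurableSpace S] {K : ℕ} {Θ : Type*} [MeasurableSpace Θ] {N h : ℕ}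
  [MeasurableSingletonClass S]

attribute [local irreducible] likelihood jointLikelihood

lemma beliefLaw_eq_withDensity (M : Model S K Θ) (s : S) (a : Fin K) (H : History S K N h)
    (h0 : M.evidence s a H ≠ 0) (h1 : M.evidence s a H ≠ ∞) :
    M.beliefLaw s a H =
      (M.prior s a).withDensity fun ϑ => (M.evidence s a H)⁻¹ * M.likelihood s a H ϑ := by
  unfold beliefLaw
  rw [if_neg (by tauto), ← withDensity_smul _ (M.measurable_likelihood_right s a H)]
  rfl

variable [Fintype S]

lemma lintegral_jointLikelihood (M : Model S K Θ) (H : History S K N h) :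
    ∫⁻ θ, M.jointLikelihood H θ ∂M.jointPrior = ∏ s, ∏ a, M.evidence s a H := by
  unfold jointLikelihood jointPrior
  rw [lintegral_pi_prod (fun s => Measure.pi fun a => M.prior s a)
    (f := fun s v => ∏ a, M.likelihood s a H (v a)) fun s => Finset.measurable_prod _ fun a _ =>
      (M.measurable_likelihood_right s a H).comp (measurable_pi_apply a)]
  refine Finset.prod_congr rfl fun s _ => ?_
  exact lintegral_pi_prod _ fun a => M.measurable_likelihood_right s a H

lemma jointBelief_eq_withDensity (M : Model S K Θ) (H : History S K N h)
    (h0 : ∀ s a, M.evidence s a H ≠ 0) (h1 : ∀ s a, M.evidence s a H ≠ ∞) :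
    M.jointBelief H = M.jointPrior.withDensity
      fun θ => ∏ s, ∏ a, ((M.evidence s a H)⁻¹ * M.likelihood s a H (θ s a)) := by
  have hm : ∀ s a, Measurable fun ϑ => (M.evidence s a H)⁻¹ * M.likelihood s a H ϑ :=
    fun s a => measurable_const.mul (M.measurable_likelihood_right s a H)
  exact pi_pi_withDensity M.prior (fun s a => M.beliefLaw s a H)
    (f := fun s a ϑ => (M.evidence s a H)⁻¹ * M.likelihood s a H ϑ) hm
    fun s a => beliefLaw_eq_withDensity M s a H (h0 s a) (h1 s a)

/-- Bayes' rule: when the evidence is finite, the joint likelihood is the density of the joint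
belief, up to normalization. -/
lemma lintegral_mul_jointLikelihood (M : Model S K Θ) (H : History S K N h)
    (hE : ∏ s, ∏ a, M.evidence s a H ≠ ∞) {f : Params S K Θ → ℝ≥0∞} (hf : Measurable f) :
    ∫⁻ θ, f θ * M.jointLikelihood H θ ∂M.jointPrior =
      (∫⁻ θ, f θ ∂(M.jointBelief H)) * ∏ s, ∏ a, M.evidence s a H := by
  have hΛ : Measurable fun θ => M.jointLikelihood H θ :=
    M.measurable_jointLikelihood.comp (measurable_const.prodMk measurable_id)
  by_cases h0 : ∏ s, ∏ a, M.evidence s a H = 0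
  -- With zero evidence the likelihood vanishes almost everywhere under the prior, so the default
  -- value of the belief is immaterial.
  · rw [h0, mul_zero]
    rw [← lintegral_jointLikelihood, lintegral_eq_zero_iff hΛ] at h0
    refine lintegral_eq_zero_of_ae_eq_zero ?_
    filter_upwards [h0] with θ hθ
    simp [hθ]
  · have hne : ∀ s a, M.evidence s a H ≠ 0 := fun s a hsa =>
      h0 (Finset.prod_eq_zero (Finset.mem_univ s) (Finset.prod_eq_zero (Finset.mem_univ a) hsa))
    -- In `ℝ≥0∞` an infinite factor could be hidden by a zero one; here no factor is zero, so it
    -- would make the product infinite.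
    have hfin : ∀ s a, M.evidence s a H ≠ ∞ := fun s a hsa => hE <| by
      classical
      rw [← Finset.mul_prod_erase _ _ (Finset.mem_univ s),
        ← Finset.mul_prod_erase _ _ (Finset.mem_univ a), hsa]
      rw [ENNReal.top_mul (Finset.prod_ne_zero_iff.2 fun b _ => hne s b), ENNReal.top_mul]
      exact Finset.prod_ne_zero_iff.2 fun t _ => Finset.prod_ne_zero_iff.2 fun b _ => hne t b
    have hden : Measurable fun θ : Params S K Θ =>
        ∏ s, ∏ a, ((M.evidence s a H)⁻¹ * M.likelihood s a H (θ s a)) :=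
      Finset.measurable_prod _ fun s _ => Finset.measurable_prod _ fun a _ =>
        measurable_const.mul ((M.measurable_likelihood_right s a H).comp
          ((measurable_pi_apply a).comp (measurable_pi_apply s)))
    rw [jointBelief_eq_withDensity M H hne hfin,
      lintegral_withDensity_eq_lintegral_mul _ hden hf, ← lintegral_mul_const _ (hden.mul hf)]
    refine lintegral_congr fun θ => ?_
    simp only [Pi.mul_apply]
    rw [mul_right_comm, mul_comm (f θ), jointLikelihood, ← Finset.prod_mul_distrib]
    congr 1
    refine Finset.prod_congr rfl fun s _ => ?_
    rw [← Finset.prod_mul_distrib]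
    refine Finset.prod_congr rfl fun a _ => ?_
    rw [mul_right_comm, ENNReal.inv_mul_cancel (hne s a) (hfin s a), one_mul]

lemma measurable_jointBelief (M : Model S K Θ) :
    Measurable fun H : History S K N h => M.jointBelief H :=
  measurable_measure_pi _ (fun _ _ => inferInstance) fun s =>
    measurable_measure_pi _ (fun _ _ => inferInstance) fun a => M.measurable_beliefLaw s a

/-- `jointBelief` as a probability kernel. -/
def belief (M : Model S K Θ) (N h : ℕ) : Kernel (History S K N h) (Params S K Θ) :=
  ⟨fun H => M.jointBelief H, M.measurable_jointBelief⟩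

instance (M : Model S K Θ) : IsMarkovKernel (M.belief N h) :=
  ⟨fun H => inferInstanceAs (IsProbabilityMeasure (M.jointBelief H))⟩

/-- The joint belief is the conditional law of the parameters given the history. -/
theorem lintegral_run_eq_lintegral_belief (M : Model S K Θ) (ρ : ArgmaxRule K)
    {f : Params S K Θ × History S K N h → ℝ≥0∞} (hf : Measurable f) :
    ∫⁻ x, f x ∂(M.run ρ N h) = ∫⁻ x, ∫⁻ θ, f (θ, x.2) ∂(M.jointBelief x.2) ∂(M.run ρ N h) := by
  obtain ⟨ν, hν, hrun⟩ := M.exists_run_eq_likelihood (N := N) (h := h) ρ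
  have hm : Measurable fun H : History S K N h => ∏ s, ∏ a, M.evidence s a H := by
    refine Finset.measurable_prod _ fun s _ => Finset.measurable_prod _ fun a _ => ?_
    exact (M.measurable_likelihood s a).lintegral_prod_right'
  have hfin : ∀ᵐ H ∂ν, ∏ s, ∏ a, M.evidence s a H ≠ ∞ := by
    refine (ae_lt_top hm ?_).mono fun H hH => hH.ne
    -- Total mass 1 of the run is the ν-integral of the product of evidences, which is therefore
    -- finite ν-almost everywhere.
    have h1 := hrun (fun _ => 1) measurable_const
    simp only [one_mul, lintegral_jointLikelihood, lintegral_one, measure_univ] at h1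
    rw [← h1]
    exact ENNReal.one_ne_top
  have hg : Measurable fun H : History S K N h => ∫⁻ θ, f (θ, H) ∂(M.jointBelief H) :=
    (hf.comp measurable_swap).lintegral_kernel_prod_right' (κ := M.belief N h)
  have hg2 : Measurable fun x : Params S K Θ × History S K N h =>
      ∫⁻ θ, f (θ, x.2) ∂(M.jointBelief x.2) := hg.comp measurable_snd
  rw [hrun f hf, hrun _ hg2]
  refine lintegral_congr_ae ?_
  filter_upwards [hfin] with H hH
  rw [lintegral_mul_jointLikelihood M H hH (f := fun θ => f (θ, H))
      (hf.comp (measurable_id.prodMk measurable_const)),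
    lintegral_mul_jointLikelihood M H hH (f := fun _ => _) measurable_const, lintegral_const,
    measure_univ, mul_one]

/-- Given the history, the action that Thompson sampling takes has the same law as the optimal
action. -/
theorem lintegral_agent_eq_lintegral_optimal (M : Model S K Θ) (ρ : ArgmaxRule K)
    {f : History S K N h × S × Fin K → ℝ≥0∞} (hf : Measurable f) :
    ∫⁻ x, ∫⁻ y, f (x.2, y.1, y.2.1) ∂(M.agent ρ N h x) ∂(M.run ρ N h) =
      ∫⁻ x, ∫⁻ y, f (x.2, y.1, ρ.select fun a => M.mean y.1 a (x.1 y.1 a)) ∂(M.agent ρ N h x)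
        ∂(M.run ρ N h) := by
  have hact : ∀ s, Measurable fun θ : Params S K Θ => ρ.select fun a => M.mean s a (θ s a) :=
    fun s => (M.measurable_sampledAction ρ s).comp (measurable_pi_apply s)
  have hfs : ∀ H s, Measurable fun a => f (H, s, a) := fun H s =>
    hf.comp (measurable_const.prodMk (measurable_const.prodMk measurable_id))
  have hl : ∀ x : Params S K Θ × History S K N h,
      ∫⁻ y, f (x.2, y.1, y.2.1) ∂(M.agent ρ N h x) =
        ∫⁻ s, ∫⁻ θ, f (x.2, s, ρ.select fun a => M.mean s a (θ s a)) ∂(M.jointBelief x.2)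
          ∂M.stateLaw := fun x => by
    rw [← Prod.mk.eta (p := x), lintegral_agent M ρ x.1 x.2 (f := fun y => f (x.2, y.1, y.2.1))
      (hf.comp (by fun_prop))]
    refine lintegral_congr fun s => ?_
    simp only [lintegral_const, measure_univ, mul_one]
    -- The policy samples the block of state `s` only, which is the marginal of the joint belief at
    -- `s`.
    rw [policyLaw, lintegral_map (hfs x.2 s) (M.measurable_sampledAction ρ s)]
    exact ((measurePreserving_eval (fun s => Measure.pi fun a => M.beliefLaw s a x.2)
      s).lintegral_comp ((hfs x.2 s).comp (M.measurable_sampledAction ρ s))).symm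
  have hr : ∀ x : Params S K Θ × History S K N h,
      ∫⁻ y, f (x.2, y.1, ρ.select fun a => M.mean y.1 a (x.1 y.1 a)) ∂(M.agent ρ N h x) =
        ∫⁻ s, f (x.2, s, ρ.select fun a => M.mean s a (x.1 s a)) ∂M.stateLaw := fun x => by
    have hm : Measurable fun s => f (x.2, s, ρ.select fun a => M.mean s a (x.1 s a)) :=
      measurable_of_countable _
    rw [← Prod.mk.eta (p := x), lintegral_agent M ρ x.1 x.2
      (f := fun y => f (x.2, y.1, ρ.select fun a => M.mean y.1 a (x.1 y.1 a)))
      (hm.comp measurable_fst)]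
    refine lintegral_congr fun s => ?_
    simp
  have hq : Measurable fun q : (Params S K Θ × History S K N h) × S =>
      f (q.1.2, q.2, ρ.select fun a => M.mean q.2 a (q.1.1 q.2 a)) :=
    measurable_from_prod_countable_left fun s => hf.comp
      (measurable_snd.prodMk (measurable_const.prodMk ((hact s).comp measurable_fst)))
  simp only [hl, hr]
  -- The true parameters are replaced by a draw from the posterior; after exchanging it with the
  -- state, this is the sampled action.
  rw [lintegral_run_eq_lintegral_belief M ρ (f := fun x =>
    ∫⁻ s, f (x.2, s, ρ.select fun a => M.mean s a (x.1 s a)) ∂M.stateLaw)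
    hq.lintegral_prod_right']
  refine lintegral_congr fun x => ?_
  refine lintegral_lintegral_swap (Measurable.aemeasurable ?_)
  exact hq.comp ((measurable_snd.prodMk measurable_const).prodMk measurable_fst)

end Model

/-! ### Numbers of pulls and sums of rewards. -/

section Counts

variable {S : Type*} {K N h : ℕ}

open Classical in
/-- `1` if action `a` was taken in state `s`, and `0` otherwise. -/
def hit (s : S) (a : Fin K) (y : Obs S K) : ℕ :=
  if y.1 = s ∧ y.2.1 = a then 1 else 0

/-- How often action `a` was taken in state `s`. -/
def pulls (s : S) (a : Fin K) (H : History S K N h) : ℕ :=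
  ∑ l, ∑ n, hit s a (H l n)

/-- The sum of the rewards of action `a` in state `s`. -/
def rewardSum (s : S) (a : Fin K) (H : History S K N h) : ℝ :=
  ∑ l, ∑ n, hit s a (H l n) * (H l n).2.2

lemma hit_le_one (s : S) (a : Fin K) (y : Obs S K) : hit s a y ≤ 1 := by
  unfold hit
  split_ifs <;> simp

lemma sum_hit_le (s : S) (a : Fin K) (y : Fin N → Obs S K) : ∑ n, hit s a (y n) ≤ N := by
  simpa using Finset.sum_le_card_nsmul Finset.univ _ 1 fun n _ => hit_le_one s a (y n)

lemma sum_hit_mul [Fintype S] (y : Obs S K) (f : S → Fin K → ℝ) :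
    ∑ s, ∑ a, (hit s a y : ℝ) * f s a = f y.1 y.2.1 := by
  classical
  unfold hit
  rw [Finset.sum_eq_single y.1, Finset.sum_eq_single y.2.1] <;> simp +contextual
  · intro b hb
    simp [Ne.symm hb]
  · intro b hb
    simp [Ne.symm hb]

lemma pulls_snoc (s : S) (a : Fin K) (H : History S K N h) (y : Fin N → Obs S K) :
    pulls s a (Fin.snoc H y : History S K N (h + 1)) = pulls s a H + ∑ n, hit s a (y n) := by
  simp [pulls, Fin.sum_univ_castSucc]

lemma pulls_le (s : S) (a : Fin K) (H : History S K N h) : pulls s a H ≤ N * h := by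
  have := Finset.sum_le_card_nsmul Finset.univ _ N fun l _ => sum_hit_le s a (H l)
  simpa [mul_comm, pulls] using this

lemma sum_pulls [Fintype S] (H : History S K N h) :
    ∑ s, ∑ a, (pulls s a H : ℝ) = N * h := by
  have h1 : ∀ y : Obs S K, ∑ s, ∑ a, (hit s a y : ℝ) = 1 := fun y => by
    simpa using sum_hit_mul y fun _ _ => 1
  have h2 : ∀ s a, (pulls s a H : ℝ) = ∑ p : Fin h × Fin N, (hit s a (H p.1 p.2) : ℝ) :=
    fun s a => by simp [pulls, Fintype.sum_prod_type]
  simp only [h2]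
  rw [Finset.sum_congr rfl fun s _ => Finset.sum_comm, Finset.sum_comm]
  simp [h1, mul_comm]

lemma rewardSum_eq_zero {s : S} {a : Fin K} {H : History S K N h} (h0 : pulls s a H = 0) :
    rewardSum s a H = 0 := by
  refine Finset.sum_eq_zero fun l _ => Finset.sum_eq_zero fun n _ => ?_
  have h1 := Finset.sum_eq_zero_iff.1 (Finset.sum_eq_zero_iff.1 h0 l (Finset.mem_univ l)) n
    (Finset.mem_univ n)
  simp [h1]

variable [MeasurableSpace S] [MeasurableSingletonClass S]

@[fun_prop]
lemma measurable_hit (s : S) (a : Fin K) : Measurable (hit s a) := by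
  unfold hit
  refine Measurable.ite ?_ measurable_const measurable_const
  exact ((measurableSet_singleton s).preimage measurable_fst).inter
    ((measurableSet_singleton a).preimage measurable_snd.fst)

@[fun_prop]
lemma measurable_pulls (s : S) (a : Fin K) :
    Measurable (pulls s a : History S K N h → ℕ) := by
  unfold pulls
  fun_prop

@[fun_prop]
lemma measurable_rewardSum (s : S) (a : Fin K) :
    Measurable (rewardSum s a : History S K N h → ℝ) := by
  have hc : Measurable fun n : ℕ => (n : ℝ) := measurable_of_countable _
  unfold rewardSum
  refine Finset.measurable_sum _ fun l _ => Finset.measurable_sum _ fun n _ => ?_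
  exact (hc.comp ((measurable_hit s a).comp (by fun_prop))).mul (by fun_prop)

end Counts

/-! ### Concentration of the rewards. -/

namespace Model

variable {S : Type*} [MeasurableSpace S] {K : ℕ} {Θ : Type*} [MeasurableSpace Θ] {N h : ℕ}

/-- The exponent that one record contributes to the exponential weight of the rewards of
action `a` in state `s`. -/
def noiseExponent (M : Model S K Θ) (s : S) (a : Fin K) (t : ℝ) (ϑ : Θ) (y : Obs S K) : ℝ :=
  hit s a y * (t * (y.2.2 - M.mean s a ϑ) - t ^ 2 / 2)

/-- The exponential weight of the rewards of action `a` in state `s`. -/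
def expNoise (M : Model S K Θ) (s : S) (a : Fin K) (t : ℝ)
    (x : Params S K Θ × History S K N h) : ℝ≥0∞ :=
  ∏ l, ∏ n, ENNReal.ofReal (Real.exp (M.noiseExponent s a t (x.1 s a) (x.2 l n)))

/-- The centred sum of the rewards of action `a` in state `s`. -/
def noise (M : Model S K Θ) (s : S) (a : Fin K) (x : Params S K Θ × History S K N h) : ℝ :=
  rewardSum s a x.2 - M.mean s a (x.1 s a) * pulls s a x.2

lemma expNoise_eq (M : Model S K Θ) (s : S) (a : Fin K) (t : ℝ)
    (x : Params S K Θ × History S K N h) :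
    M.expNoise s a t x =
      ENNReal.ofReal (Real.exp (t * M.noise s a x - t ^ 2 / 2 * pulls s a x.2)) := by
  have h1 : t * M.noise s a x - t ^ 2 / 2 * pulls s a x.2 =
      ∑ l, ∑ n, M.noiseExponent s a t (x.1 s a) (x.2 l n) := by
    unfold noise noiseExponent rewardSum pulls
    push_cast
    simp only [Finset.mul_sum, ← Finset.sum_sub_distrib]
    refine Finset.sum_congr rfl fun l _ => Finset.sum_congr rfl fun n _ => ?_
    ring
  rw [h1, Real.exp_sum, ENNReal.ofReal_prod_of_nonneg fun l _ => (Real.exp_pos _).le]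
  refine Finset.prod_congr rfl fun l _ => ?_
  rw [Real.exp_sum, ENNReal.ofReal_prod_of_nonneg fun n _ => (Real.exp_pos _).le]

lemma expNoise_snoc (M : Model S K Θ) (s : S) (a : Fin K) (t : ℝ) (θ : Params S K Θ)
    (H : History S K N h) (y : Fin N → Obs S K) :
    M.expNoise s a t (θ, (Fin.snoc H y : History S K N (h + 1))) =
      M.expNoise s a t (θ, H) *
        ∏ n, ENNReal.ofReal (Real.exp (M.noiseExponent s a t (θ s a) (y n))) := by
  unfold expNoise
  rw [Fin.prod_univ_castSucc]
  simp only [Fin.snoc_castSucc, Fin.snoc_last]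

variable [MeasurableSingletonClass S]

@[fun_prop]
lemma measurable_noise (M : Model S K Θ) (s : S) (a : Fin K) :
    Measurable (M.noise s a : Params S K Θ × History S K N h → ℝ) := by
  have hc : Measurable fun n : ℕ => (n : ℝ) := measurable_of_countable _
  have hm : Measurable fun x : Params S K Θ × History S K N h => M.mean s a (x.1 s a) :=
    (M.measurable_mean s a).comp (by fun_prop)
  exact ((measurable_rewardSum s a).comp measurable_snd).sub
    (hm.mul (hc.comp ((measurable_pulls s a).comp measurable_snd)))

@[fun_prop]
lemma measurable_expNoise (M : Model S K Θ) (s : S) (a : Fin K) (t : ℝ) :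
    Measurable (M.expNoise s a t : Params S K Θ × History S K N h → ℝ≥0∞) := by
  have hc : Measurable fun n : ℕ => (n : ℝ) := measurable_of_countable _
  have hp : Measurable fun x : Params S K Θ × History S K N h => (pulls s a x.2 : ℝ) :=
    hc.comp ((measurable_pulls s a).comp measurable_snd)
  rw [funext (M.expNoise_eq s a t)]
  exact ((((M.measurable_noise s a).const_mul t).sub (hp.const_mul _)).exp).ennreal_ofReal

lemma measurable_noiseExponent (M : Model S K Θ) (s : S) (a : Fin K) (t : ℝ) (ϑ : Θ) :
    Measurable (M.noiseExponent s a t ϑ) := by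
  have hc : Measurable fun n : ℕ => (n : ℝ) := measurable_of_countable _
  unfold noiseExponent
  exact (hc.comp (measurable_hit s a)).mul (by fun_prop)

variable [Fintype S]

/-- If the record belongs to the pair, sub-Gaussianity gives at most exp(t²/2) and the compensator
cancels it; otherwise the exponent is 0. -/
lemma lintegral_agent_exp_noiseExponent_le (M : Model S K Θ) (hM : M.IsNormalized)
    (ρ : ArgmaxRule K) (s : S) (a : Fin K) (t : ℝ) (θ : Params S K Θ) (H : History S K N h) :
    ∫⁻ y, ENNReal.ofReal (Real.exp (M.noiseExponent s a t (θ s a) y)) ∂(M.agent ρ N h (θ, H))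
      ≤ 1 := by
  have hone : ∀ s' a', ∫⁻ r, ENNReal.ofReal
      (Real.exp (M.noiseExponent s a t (θ s a) (s', a', r))) ∂(M.rewardLaw s' a' (θ s' a'))
        ≤ 1 := fun s' a' => by
    by_cases hsa : s' = s ∧ a' = a
    · obtain ⟨rfl, rfl⟩ := hsa
      have hsub := hM.subgaussian s' a' (θ s' a')
      have hmgf := hsub.mgf_le t
      have hint := hsub.integrable_exp_mul t
      have he : ∀ r, Real.exp (M.noiseExponent s' a' t (θ s' a') (s', a', r)) =
          Real.exp (t * (r - M.mean s' a' (θ s' a'))) * Real.exp (-(t ^ 2 / 2)) := fun r => by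
        rw [← Real.exp_add]
        simp [noiseExponent, hit, sub_eq_add_neg]
      simp only [he]
      rw [← ofReal_integral_eq_lintegral_ofReal (hint.mul_const _)
        (Filter.Eventually.of_forall fun r => by positivity), integral_mul_const,
        ENNReal.ofReal_le_one]
      calc _ ≤ Real.exp (((1 : NNReal) : ℝ) * t ^ 2 / 2) * Real.exp (-(t ^ 2 / 2)) := by
            gcongr
            exact hmgf
        _ = 1 := by rw [← Real.exp_add]; simp
    · simp [noiseExponent, hit, hsa]
  rw [lintegral_agent M ρ θ H (M.measurable_noiseExponent s a t (θ s a)).exp.ennreal_ofReal]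
  calc _ ≤ ∫⁻ s', ∫⁻ _, 1 ∂(M.policyLaw ρ H s') ∂M.stateLaw := by
        gcongr with s' a'
        exact hone s' a'
    _ = 1 := by simp

/-- The exponential supermartingale has expectation at most `1`. -/
theorem lintegral_expNoise_le (M : Model S K Θ) (hM : M.IsNormalized)
    (ρ : ArgmaxRule K) (s : S) (a : Fin K) (t : ℝ) :
    ∫⁻ x, M.expNoise s a t x ∂(M.run ρ N h) ≤ 1 := by
  induction h with
  | zero => simp [expNoise]
  | succ h ih =>
    rw [lintegral_run_succ M ρ (M.measurable_expNoise s a t)]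
    refine le_trans (lintegral_mono fun x => ?_) ih
    have hm := (M.measurable_noiseExponent s a t (x.1 s a)).exp.ennreal_ofReal
    have hm' : Measurable fun y : Fin N → Obs S K =>
        ∏ n, ENNReal.ofReal (Real.exp (M.noiseExponent s a t (x.1 s a) (y n))) :=
      Finset.measurable_prod _ fun n _ => hm.comp (measurable_pi_apply n)
    simp only [expNoise_snoc]
    rw [lintegral_const_mul _ hm']
    change _ * ∫⁻ y, _ ∂(Measure.pi fun _ => M.agent ρ N h x) ≤ _
    -- Conditional independence of the agents within the round lets each factor be bounded by 1
    -- separately.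
    rw [lintegral_pi_prod (fun _ => M.agent ρ N h x) fun _ => hm]
    refine mul_le_of_le_one_right' (Finset.prod_le_one' fun n _ => ?_)
    exact lintegral_agent_exp_noiseExponent_le M hM ρ s a t x.1 x.2

/-- The event that the rewards of action `a` in state `s` deviate from their mean, in the direction
of the sign of `σ`. -/
def deviation (M : Model S K Θ) (β σ : ℝ) (s : S) (a : Fin K) :
    Set (Params S K Θ × History S K N h) :=
  {x | Real.sqrt (β * pulls s a x.2) < σ * M.noise s a x}

omit [Fintype S] in
lemma measurableSet_deviation (M : Model S K Θ) (β σ : ℝ) (s : S) (a : Fin K) :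
    MeasurableSet (M.deviation β σ s a : Set (Params S K Θ × History S K N h)) := by
  have hc : Measurable fun n : ℕ => (n : ℝ) := measurable_of_countable _
  have hp : Measurable fun x : Params S K Θ × History S K N h => (pulls s a x.2 : ℝ) :=
    hc.comp ((measurable_pulls s a).comp measurable_snd)
  exact measurableSet_lt (hp.const_mul β).sqrt ((M.measurable_noise s a).const_mul σ)

/-- The best exponent t depends on the number of pulls, which is random and correlated with the
rewards. The factor `N * h` is the price of a union bound over its possible values. -/
theorem measure_deviation_le (M : Model S K Θ) (hM : M.IsNormalized) (ρ : ArgmaxRule K)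
    {β σ : ℝ} (hβ : 0 ≤ β) (hσ : σ ^ 2 = 1) (s : S) (a : Fin K) :
    M.run ρ N h (M.deviation β σ s a) ≤ ENNReal.ofReal ((N * h : ℕ) * Real.exp (-(β / 2))) := by
  have hsub : M.deviation β σ s a ⊆ ⋃ k ∈ Finset.Icc 1 (N * h),
      {x : Params S K Θ × History S K N h | ENNReal.ofReal (Real.exp (β / 2)) ≤
        M.expNoise s a (σ * Real.sqrt (β / k)) x} := by
    intro x hx
    rw [deviation, Set.mem_ofPred_eq] at hx
    -- Without pulls both sides of the strict inequality are 0, so the union can start at 1.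
    have hpos : pulls s a x.2 ≠ 0 := fun h0 => by
      simp [noise, h0, rewardSum_eq_zero h0] at hx
    simp only [Set.mem_iUnion, Set.mem_ofPred_eq, Finset.mem_Icc]
    -- With k pulls, t = √(β/k) maximizes t√(βk) - t²k/2, and the maximum is β/2.
    refine ⟨pulls s a x.2, ⟨Nat.one_le_iff_ne_zero.2 hpos, pulls_le s a x.2⟩, ?_⟩
    rw [expNoise_eq]
    refine ENNReal.ofReal_le_ofReal (Real.exp_le_exp.2 ?_)
    have hk : (0 : ℝ) < pulls s a x.2 := by exact_mod_cast Nat.pos_of_ne_zero hpos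
    generalize (pulls s a x.2 : ℝ) = k at hx hk
    have h1 : Real.sqrt (β / k) * Real.sqrt (β * k) = β := by
      rw [← Real.sqrt_mul (by positivity)]
      rw [show β / k * (β * k) = β ^ 2 by field_simp, Real.sqrt_sq hβ]
    have h2 : (σ * Real.sqrt (β / k)) ^ 2 / 2 * k = β / 2 := by
      rw [mul_pow, hσ, Real.sq_sqrt (by positivity)]
      field_simp
    have h3 : Real.sqrt (β / k) * Real.sqrt (β * k) ≤
        Real.sqrt (β / k) * (σ * M.noise s a x) := by gcongr
    rw [h2]
    nlinarith
  have hone : ∀ t : ℝ, M.run ρ N h {x | ENNReal.ofReal (Real.exp (β / 2)) ≤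
      M.expNoise s a t x} ≤ ENNReal.ofReal (Real.exp (-(β / 2))) := fun t => by
    have h1 := (mul_meas_ge_le_lintegral (μ := M.run ρ N h) (M.measurable_expNoise s a t)
      (ENNReal.ofReal (Real.exp (β / 2)))).trans (lintegral_expNoise_le M hM ρ s a t)
    rw [Real.exp_neg, ENNReal.ofReal_inv_of_pos (Real.exp_pos _)]
    rw [ENNReal.le_inv_iff_mul_le, mul_comm]
    exact h1
  calc _ ≤ M.run ρ N h (⋃ k ∈ Finset.Icc 1 (N * h),
      {x : Params S K Θ × History S K N h | ENNReal.ofReal (Real.exp (β / 2)) ≤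
        M.expNoise s a (σ * Real.sqrt (β / k)) x}) := measure_mono hsub
    _ ≤ ∑ k ∈ Finset.Icc 1 (N * h), ENNReal.ofReal (Real.exp (-(β / 2))) :=
        (measure_biUnion_finset_le _ _).trans (Finset.sum_le_sum fun k _ => hone _)
    _ = _ := by
        rw [ENNReal.ofReal_mul (by positivity)]
        simp

end Model

/-! ### Confidence widths, their potential, and upper confidence bounds. -/

section Confidence

/-- The contribution to the regret bound of an action that was taken `n` times before. -/
def width (β : ℝ) (n : ℕ) : ℝ := if n = 0 then 1 else min 1 (2 * Real.sqrt (β / n))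

lemma width_le_one (β : ℝ) (n : ℕ) : width β n ≤ 1 := by
  unfold width
  split_ifs <;> simp

lemma width_nonneg (β : ℝ) (n : ℕ) : 0 ≤ width β n := by
  unfold width
  split_ifs <;> positivity

lemma width_mul_sqrt_le {β : ℝ} (hβ : 0 ≤ β) (n : ℕ) :
    width β n * Real.sqrt n ≤ 2 * Real.sqrt β := by
  unfold width
  split_ifs with h0
  · simp [h0]
  · have hn : (0 : ℝ) < n := by exact_mod_cast Nat.pos_of_ne_zero h0
    calc _ ≤ 2 * Real.sqrt (β / n) * Real.sqrt n := by gcongr; exact min_le_right _ _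
      _ = 2 * Real.sqrt β := by
        rw [mul_assoc, ← Real.sqrt_mul (by positivity), div_mul_cancel₀ _ hn.ne']

/-- The total contribution to the regret bound of an action that was taken `n` times, up to `N`
times in each round. -/
def potential (β : ℝ) (N n : ℕ) : ℝ :=
  (min n N : ℕ) + 4 * Real.sqrt β * Real.sqrt (n - N : ℕ)

lemma potential_nonneg (β : ℝ) (N n : ℕ) : 0 ≤ potential β N n := by
  unfold potential; positivity

lemma potential_le (β : ℝ) (N n : ℕ) : potential β N n ≤ N + 4 * Real.sqrt β * Real.sqrt n := by
  unfold potential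
  gcongr
  · exact min_le_right _ _
  · exact Nat.sub_le _ _

/-- All `d` pulls of a round pay the width at the old count `n`. Shifting the potential by `N`
compensates: since `d ≤ N`, even the new shifted count n + d - N is at most `n`, so the stale width
still controls the increment of the square root. -/
lemma mul_width_le {β : ℝ} (hβ : 0 ≤ β) {N d : ℕ} (hd : d ≤ N) (n : ℕ) :
    d * width β n ≤ potential β N (n + d) - potential β N n := by
  unfold potential
  have hv : min n N ≤ min (n + d) N := by omega
  have hu : n - N ≤ n + d - N := by omega
  have hsum : d + min n N + (n - N) = min (n + d) N + (n + d - N) := by omega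
  have hun : n + d - N ≤ n := by omega
  generalize min n N = v at *
  generalize min (n + d) N = v' at *
  generalize n - N = u at *
  generalize n + d - N = u' at *
  have hv : (v : ℝ) ≤ v' := by exact_mod_cast hv
  have hu : (u : ℝ) ≤ u' := by exact_mod_cast hu
  have hsum : (d : ℝ) + v + u = v' + u' := by exact_mod_cast hsum
  have hun : Real.sqrt u' ≤ Real.sqrt n := Real.sqrt_le_sqrt (by exact_mod_cast hun)
  have h1 := width_le_one β n
  have h0 := width_nonneg β n
  have hw := width_mul_sqrt_le hβ n
  have hx := Real.sqrt_le_sqrt hu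
  have hx0 := Real.sqrt_nonneg (u : ℝ)
  have hsq : (u : ℝ) = Real.sqrt u ^ 2 := (Real.sq_sqrt (by positivity)).symm
  have hsq' : (u' : ℝ) = Real.sqrt u' ^ 2 := (Real.sq_sqrt (by positivity)).symm
  generalize Real.sqrt (u : ℝ) = p at *
  generalize Real.sqrt (u' : ℝ) = q at *
  -- The `d` pulls split into those among the first `N`, charged at most 1 each, and the rest, u' -
  -- u = (q - p)(q + p), where q + p ≤ 2√n.
  have h2 : (d : ℝ) * width β n = (v' - v) * width β n + (q - p) * ((q + p) * width β n) := by
    rw [show (d : ℝ) = (v' - v) + (u' - u) by linarith, hsq, hsq']; ring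
  have h3 : (v' - v : ℝ) * width β n ≤ v' - v := mul_le_of_le_one_right (by linarith) h1
  have h4 : (q + p) * width β n ≤ 4 * Real.sqrt β := by nlinarith
  have h5 := mul_le_mul_of_nonneg_left h4 (sub_nonneg.2 hx)
  rw [h2]
  linarith

variable {S : Type*} {K N h : ℕ}

/-- The upper confidence bound of action `a` in state `s` after the history `H`. -/
def upper (β : ℝ) (s : S) (a : Fin K) (H : History S K N h) : ℝ :=
  if pulls s a H = 0 then 1
  else max 0 (min 1 (rewardSum s a H / pulls s a H + Real.sqrt (β / pulls s a H)))

lemma upper_nonneg (β : ℝ) (s : S) (a : Fin K) (H : History S K N h) : 0 ≤ upper β s a H := by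
  unfold upper
  split_ifs <;> simp

lemma upper_le_one (β : ℝ) (s : S) (a : Fin K) (H : History S K N h) : upper β s a H ≤ 1 := by
  unfold upper
  split_ifs <;> simp

lemma measurable_upper [MeasurableSpace S] [MeasurableSingletonClass S] (β : ℝ) (s : S)
    (a : Fin K) : Measurable (upper β s a : History S K N h → ℝ) := by
  have hc : Measurable fun n : ℕ => (n : ℝ) := measurable_of_countable _
  have hp : Measurable fun H : History S K N h => (pulls s a H : ℝ) :=
    hc.comp (measurable_pulls s a)
  unfold upper
  refine Measurable.ite ((measurableSet_singleton 0).preimage (measurable_pulls s a))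
    measurable_const ?_
  exact measurable_const.max (measurable_const.min
    (((measurable_rewardSum s a).div hp).add (hp.const_div β).sqrt))

lemma sqrt_mul_eq_sqrt_div_mul {β k : ℝ} (hk : 0 < k) : Real.sqrt (β * k) = Real.sqrt (β / k) * k := by
  rw [show β * k = β / k * k ^ 2 by field_simp, Real.sqrt_mul' _ (by positivity),
    Real.sqrt_sq hk.le]

namespace Model

variable [MeasurableSpace S] {Θ : Type*} [MeasurableSpace Θ]

lemma mean_le_upper (M : Model S K Θ) (hM : M.IsNormalized) {β : ℝ} {s : S} {a : Fin K}
    {x : Params S K Θ × History S K N h} (hx : x ∉ M.deviation β (-1) s a) :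
    M.mean s a (x.1 s a) ≤ upper β s a x.2 := by
  have hm := (hM.mean_mem s a (x.1 s a)).2
  unfold upper
  split_ifs with h0
  · exact hm
  refine le_max_of_le_right (le_min hm ?_)
  have hk : (0 : ℝ) < pulls s a x.2 := by exact_mod_cast Nat.pos_of_ne_zero h0
  simp only [deviation, Set.mem_ofPred_eq, not_lt, noise, sqrt_mul_eq_sqrt_div_mul hk] at hx
  rw [div_add' _ _ _ hk.ne', le_div_iff₀ hk]
  linarith

/-- The radius √(β/k) counts twice, as error of the empirical mean and as bonus; hence the 2 in
`width`. The cap at 1 survives because the mean is nonnegative. -/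
lemma upper_le_mean_add (M : Model S K Θ) (hM : M.IsNormalized) {β : ℝ} {s : S} {a : Fin K}
    {x : Params S K Θ × History S K N h} (hx : x ∉ M.deviation β 1 s a) :
    upper β s a x.2 ≤ M.mean s a (x.1 s a) + width β (pulls s a x.2) := by
  have hm := (hM.mean_mem s a (x.1 s a)).1
  unfold upper width
  split_ifs with h0
  · linarith
  have hk : (0 : ℝ) < pulls s a x.2 := by exact_mod_cast Nat.pos_of_ne_zero h0
  simp only [deviation, Set.mem_ofPred_eq, not_lt, noise, sqrt_mul_eq_sqrt_div_mul hk] at hx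
  refine max_le (by positivity) ?_
  rw [← min_add_add_left]
  refine min_le_min (by linarith) ?_
  have h1 : rewardSum s a x.2 / pulls s a x.2 ≤
      M.mean s a (x.1 s a) + Real.sqrt (β / pulls s a x.2) := by
    rw [div_le_iff₀ hk]
    linarith
  linarith

end Model

end Confidence

/-! ### Regret decomposition and summation of the widths. -/

namespace Model

variable {S : Type*} [MeasurableSpace S] {K : ℕ} {Θ : Type*} [MeasurableSpace Θ] {N h : ℕ}

/-- The optimal action in state `s`. -/
def optimal (M : Model S K Θ) (ρ : ArgmaxRule K) (θ : Params S K Θ) (s : S) : Fin K :=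
  ρ.select fun a => M.mean s a (θ s a)

/-- The regret of one record. -/
def gap (M : Model S K Θ) (ρ : ArgmaxRule K) (θ : Params S K Θ) (y : Obs S K) : ℝ :=
  M.mean y.1 (M.optimal ρ θ y.1) (θ y.1 (M.optimal ρ θ y.1)) - M.mean y.1 y.2.1 (θ y.1 y.2.1)

lemma regret_snoc (M : Model S K Θ) (ρ : ArgmaxRule K) (θ : Params S K Θ)
    (H : History S K N h) (y : Fin N → Obs S K) :
    M.regret ρ (θ, (Fin.snoc H y : History S K N (h + 1))) =
      M.regret ρ (θ, H) + ∑ n, M.gap ρ θ (y n) := by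
  unfold regret
  rw [Fin.sum_univ_castSucc]
  simp only [Fin.snoc_castSucc, Fin.snoc_last]
  rfl

lemma gap_le_one (M : Model S K Θ) (hM : M.IsNormalized) (ρ : ArgmaxRule K)
    (θ : Params S K Θ) (y : Obs S K) : M.gap ρ θ y ≤ 1 := by
  unfold gap
  linarith [(hM.mean_mem y.1 (M.optimal ρ θ y.1) (θ y.1 (M.optimal ρ θ y.1))).2,
    (hM.mean_mem y.1 y.2.1 (θ y.1 y.2.1)).1]

lemma gap_nonneg (M : Model S K Θ) (ρ : ArgmaxRule K) (θ : Params S K Θ) (y : Obs S K) :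
    0 ≤ M.gap ρ θ y :=
  sub_nonneg.2 (ρ.le_select (fun a => M.mean y.1 a (θ y.1 a)) y.2.1)

lemma regret_eq_sum_gap (M : Model S K Θ) (ρ : ArgmaxRule K)
    (x : Params S K Θ × History S K N h) :
    M.regret ρ x = ∑ l, ∑ n, M.gap ρ x.1 (x.2 l n) := rfl

lemma abs_regret_le (M : Model S K Θ) (hM : M.IsNormalized) (ρ : ArgmaxRule K)
    (x : Params S K Θ × History S K N h) : |M.regret ρ x| ≤ N * h := by
  rw [regret_eq_sum_gap, abs_of_nonneg (Finset.sum_nonneg fun l _ => Finset.sum_nonneg fun n _ =>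
    M.gap_nonneg ρ x.1 _)]
  calc _ ≤ ∑ _l : Fin h, ∑ _n : Fin N, (1 : ℝ) := by
        gcongr with l _ n _
        exact M.gap_le_one hM ρ x.1 _
    _ = _ := by simp [mul_comm]

/-- The sum of the contributions to the regret bound of all pairs of a state and an action. -/
def totalPotential [Fintype S] (β : ℝ) (H : History S K N h) : ℝ :=
  ∑ s, ∑ a, potential β N (pulls s a H)

omit [MeasurableSpace S] in
lemma totalPotential_nonneg [Fintype S] (β : ℝ) (H : History S K N h) :
    0 ≤ totalPotential β H :=
  Finset.sum_nonneg fun _ _ => Finset.sum_nonneg fun _ _ => potential_nonneg _ _ _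

omit [MeasurableSpace S] in
lemma totalPotential_le [Fintype S] {β : ℝ} (H : History S K N h) :
    totalPotential β H ≤ K * Fintype.card S * N +
      4 * Real.sqrt β * Real.sqrt (K * Fintype.card S * (N * h)) := by
  have hcs : ∑ s, ∑ a, Real.sqrt (pulls s a H) ≤
      Real.sqrt (K * Fintype.card S * (N * h)) := by
    -- Cauchy–Schwarz against the constant 1, over pairs whose counts add up to `N * h`.
    have h1 := Real.sum_sqrt_mul_sqrt_le (Finset.univ : Finset (S × Fin K))
      (f := fun _ => 1) (g := fun p => (pulls p.1 p.2 H : ℝ)) (fun _ => zero_le_one)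
      fun _ => by positivity
    simp only [Real.sqrt_one, one_mul, Fintype.sum_prod_type, sum_pulls] at h1
    refine h1.trans_eq ?_
    rw [← Real.sqrt_mul (by positivity)]
    simp [mul_comm]
  calc totalPotential β H
      ≤ ∑ s, ∑ a, ((N : ℝ) + 4 * Real.sqrt β * Real.sqrt (pulls s a H)) := by
        unfold totalPotential
        gcongr
        exact potential_le _ _ _
    _ = K * Fintype.card S * N + 4 * Real.sqrt β * ∑ s, ∑ a, Real.sqrt (pulls s a H) := by
        simp only [Finset.sum_add_distrib, Finset.mul_sum]
        simp
        ring
    _ ≤ _ := by gcongr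

omit [MeasurableSpace S] in
lemma sum_width_le [Fintype S] {β : ℝ} (hβ : 0 ≤ β) (H : History S K N h)
    (y : Fin N → Obs S K) :
    ∑ n, width β (pulls (y n).1 (y n).2.1 H) ≤
      totalPotential β (Fin.snoc H y : History S K N (h + 1)) - totalPotential β H := by
  have h1 : ∀ n, width β (pulls (y n).1 (y n).2.1 H) =
      ∑ s, ∑ a, (hit s a (y n) : ℝ) * width β (pulls s a H) := fun n =>
    (sum_hit_mul (y n) fun s a => width β (pulls s a H)).symm
  simp only [h1, totalPotential, ← Finset.sum_sub_distrib]
  rw [Finset.sum_comm]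
  refine Finset.sum_le_sum fun s _ => ?_
  rw [Finset.sum_comm]
  refine Finset.sum_le_sum fun a _ => ?_
  rw [← Finset.sum_mul, pulls_snoc]
  exact_mod_cast mul_width_le hβ (sum_hit_le s a y) _

/-- The number of confidence bounds that fail. -/
def failures [Fintype S] (M : Model S K Θ) (β : ℝ) (x : Params S K Θ × History S K N h) : ℝ :=
  ∑ s, ∑ a, ((M.deviation β (-1) s a).indicator 1 x + (M.deviation β 1 s a).indicator 1 x)

/-- The upper bound is inserted at both actions; the middle difference is kept because its
expectation is 0. A failed bound costs at most 1, as means and bounds lie in [0, 1]. Since the two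
pairs concerned are random, their indicators are dominated by the sum over all pairs. -/
lemma gap_le [Fintype S] (M : Model S K Θ) (hM : M.IsNormalized) (ρ : ArgmaxRule K) (β : ℝ)
    (x : Params S K Θ × History S K N h) (y : Obs S K) :
    M.gap ρ x.1 y ≤ M.failures β x +
      (upper β y.1 (M.optimal ρ x.1 y.1) x.2 - upper β y.1 y.2.1 x.2) +
        width β (pulls y.1 y.2.1 x.2) := by
  have hnn : ∀ σ s a, 0 ≤ (M.deviation β σ s a).indicator (1 : Params S K Θ × History S K N h → ℝ) x := fun σ s a =>
    Set.indicator_nonneg (fun _ _ => zero_le_one) _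
  have hm : ∀ s a, M.mean s a (x.1 s a) ≤
      upper β s a x.2 + (M.deviation β (-1) s a).indicator (1 : Params S K Θ × History S K N h → ℝ) x := fun s a => by
    by_cases hx : x ∈ M.deviation β (-1) s a
    · rw [Set.indicator_of_mem hx, Pi.one_apply]
      linarith [(hM.mean_mem s a (x.1 s a)).2, upper_nonneg β s a x.2]
    · rw [Set.indicator_of_notMem hx, add_zero]
      exact M.mean_le_upper hM hx
  have hu : ∀ s a, upper β s a x.2 ≤ M.mean s a (x.1 s a) + width β (pulls s a x.2) +
      (M.deviation β 1 s a).indicator (1 : Params S K Θ × History S K N h → ℝ) x := fun s a => by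
    by_cases hx : x ∈ M.deviation β 1 s a
    · rw [Set.indicator_of_mem hx, Pi.one_apply]
      linarith [(hM.mean_mem s a (x.1 s a)).1, upper_le_one β s a x.2,
        width_nonneg β (pulls s a x.2)]
    · rw [Set.indicator_of_notMem hx, add_zero]
      exact M.upper_le_mean_add hM hx
  have hle : ∀ σ s a, (M.deviation β σ s a).indicator (1 : Params S K Θ × History S K N h → ℝ) x ≤
      ∑ s, ∑ a, (M.deviation β σ s a).indicator (1 : Params S K Θ × History S K N h → ℝ) x := fun σ s a =>
    (Finset.single_le_sum (fun a _ => hnn σ s a) (Finset.mem_univ a)).trans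
      (Finset.single_le_sum (f := fun s => ∑ a, (M.deviation β σ s a).indicator (1 : Params S K Θ × History S K N h → ℝ) x)
        (fun s _ => Finset.sum_nonneg fun a _ => hnn σ s a) (Finset.mem_univ s))
  have hf : M.failures β x = ∑ s, ∑ a, (M.deviation β (-1) s a).indicator (1 : Params S K Θ × History S K N h → ℝ) x +
      ∑ s, ∑ a, (M.deviation β 1 s a).indicator (1 : Params S K Θ × History S K N h → ℝ) x := by
    simp only [failures, Finset.sum_add_distrib]
  unfold gap
  rw [hf]
  linarith [hm y.1 (M.optimal ρ x.1 y.1), hu y.1 y.2.1, hle (-1) y.1 (M.optimal ρ x.1 y.1),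
    hle 1 y.1 y.2.1]

variable [MeasurableSingletonClass S]

attribute [local irreducible] mean hit pulls rewardSum upper potential

lemma measurable_optimal [Countable S] (M : Model S K Θ) (ρ : ArgmaxRule K) :
    Measurable fun p : Params S K Θ × S => M.optimal ρ p.1 p.2 :=
  measurable_from_prod_countable_left fun s =>
    (M.measurable_sampledAction ρ s).comp (measurable_pi_apply s)

lemma measurable_mean_apply [Countable S] (M : Model S K Θ) :
    Measurable fun p : Params S K Θ × S × Fin K => M.mean p.2.1 p.2.2 (p.1 p.2.1 p.2.2) := by
  refine measurable_from_prod_countable_left fun q => ?_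
  have hm : Measurable fun θ : Params S K Θ => θ q.1 q.2 := by fun_prop
  exact (M.measurable_mean q.1 q.2).comp hm

lemma measurable_gap [Countable S] (M : Model S K Θ) (ρ : ArgmaxRule K) :
    Measurable fun p : Params S K Θ × Obs S K => M.gap ρ p.1 p.2 := by
  have h1 : Measurable fun p : Params S K Θ × Obs S K => M.optimal ρ p.1 p.2.1 :=
    (M.measurable_optimal ρ).comp (measurable_fst.prodMk measurable_snd.fst)
  have h2 : Measurable fun p : Params S K Θ × Obs S K => (p.1, p.2.1, M.optimal ρ p.1 p.2.1) :=
    measurable_fst.prodMk (measurable_snd.fst.prodMk h1)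
  have h3 : Measurable fun p : Params S K Θ × Obs S K => (p.1, p.2.1, p.2.2.1) := by fun_prop
  exact (M.measurable_mean_apply.comp h2).sub (M.measurable_mean_apply.comp h3)

attribute [local irreducible] optimal gap

lemma measurable_regret [Countable S] (M : Model S K Θ) (ρ : ArgmaxRule K) :
    Measurable (M.regret ρ : Params S K Θ × History S K N h → ℝ) := by
  rw [funext (M.regret_eq_sum_gap ρ)]
  refine Finset.measurable_sum _ fun l _ => Finset.measurable_sum _ fun n _ => ?_
  have hm : Measurable fun x : Params S K Θ × History S K N h => (x.1, x.2 l n) := by fun_prop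
  exact (M.measurable_gap ρ).comp hm

lemma measurable_upper_apply [Countable S] (β : ℝ) :
    Measurable fun p : History S K N h × S × Fin K => upper β p.2.1 p.2.2 p.1 :=
  measurable_from_prod_countable_left fun q => measurable_upper β q.1 q.2

/-! ### Expected regret, round by round. -/

variable [Fintype S]

lemma measurable_totalPotential (β : ℝ) :
    Measurable (totalPotential β : History S K N h → ℝ) := by
  refine Finset.measurable_sum _ fun s _ => Finset.measurable_sum _ fun a _ => ?_
  have hc : Measurable (potential β N) := measurable_of_countable _
  exact hc.comp (measurable_pulls s a)

attribute [local irreducible] regret totalPotential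

theorem integrable_regret (M : Model S K Θ) (hM : M.IsNormalized) (ρ : ArgmaxRule K) :
    Integrable (fun x => M.regret ρ x) (M.run ρ N h) :=
  Integrable.of_bound (M.measurable_regret ρ).aestronglyMeasurable (N * h)
    (Filter.Eventually.of_forall fun x => M.abs_regret_le hM ρ x)

lemma integrable_totalPotential (M : Model S K Θ) (ρ : ArgmaxRule K) (β : ℝ) :
    Integrable (fun x => totalPotential β x.2) (M.run ρ N h) := by
  refine Integrable.of_bound
    ((measurable_totalPotential β).comp measurable_snd).aestronglyMeasurable
    (K * Fintype.card S * N + 4 * Real.sqrt β * Real.sqrt (K * Fintype.card S * (N * h)))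
    (Filter.Eventually.of_forall fun x => ?_)
  rw [Real.norm_of_nonneg (totalPotential_nonneg β x.2)]
  exact totalPotential_le x.2

lemma integrable_failures (M : Model S K Θ) (ρ : ArgmaxRule K) (β : ℝ) :
    Integrable (M.failures β) (M.run ρ N h) := by
  refine integrable_finsetSum _ fun s _ => integrable_finsetSum _ fun a _ => ?_
  exact ((integrable_const 1).indicator (M.measurableSet_deviation β (-1) s a)).add
    ((integrable_const 1).indicator (M.measurableSet_deviation β 1 s a))

theorem integral_failures_le (M : Model S K Θ) (hM : M.IsNormalized) (ρ : ArgmaxRule K)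
    {β : ℝ} (hβ : 0 ≤ β) :
    ∫ x, M.failures β x ∂(M.run ρ N h) ≤
      2 * K * Fintype.card S * (N * h) * Real.exp (-(β / 2)) := by
  have hi : ∀ σ s a, Integrable ((M.deviation β σ s a).indicator (1 : Params S K Θ × History S K N h → ℝ)) (M.run ρ N h) :=
    fun σ s a => (integrable_const 1).indicator (M.measurableSet_deviation β σ s a)
  have hone : ∀ σ s a, σ ^ 2 = 1 → ∫ x, (M.deviation β σ s a).indicator (1 : Params S K Θ × History S K N h → ℝ) x
      ∂(M.run ρ N h) ≤ (N * h : ℕ) * Real.exp (-(β / 2)) := fun σ s a hσ => by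
    rw [integral_indicator_one (M.measurableSet_deviation β σ s a)]
    exact ENNReal.toReal_le_of_le_ofReal (by positivity) (M.measure_deviation_le hM ρ hβ hσ s a)
  have hadd : ∀ s a, Integrable (fun x => (M.deviation β (-1) s a).indicator
      (1 : Params S K Θ × History S K N h → ℝ) x + (M.deviation β 1 s a).indicator 1 x)
      (M.run ρ N h) := fun s a => (hi (-1) s a).add (hi 1 s a)
  unfold failures
  rw [integral_finsetSum _ fun s _ => integrable_finsetSum _ fun a _ => hadd s a]
  calc _ ≤ ∑ _s : S, ∑ _a : Fin K, (2 * ((N * h : ℕ) * Real.exp (-(β / 2)))) := by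
        refine Finset.sum_le_sum fun s _ => ?_
        rw [integral_finsetSum _ fun a _ => hadd s a]
        refine Finset.sum_le_sum fun a _ => ?_
        rw [integral_add (hi (-1) s a) (hi 1 s a)]
        linarith [hone (-1) s a (by norm_num), hone 1 s a (by norm_num)]
    _ = _ := by
        simp
        ring

lemma integral_run_succ (M : Model S K Θ) (ρ : ArgmaxRule K)
    {f : Params S K Θ × History S K N (h + 1) → ℝ} (hf : Measurable f) :
    ∫ x, f x ∂(M.run ρ N (h + 1)) =
      ∫ z, f (z.1.1, Fin.snoc z.1.2 z.2) ∂(M.run ρ N h ⊗ₘ M.round ρ N h) := by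
  have hm : Measurable fun x : (Params S K Θ × History S K N h) × (Fin N → Obs S K) =>
      ((x.1.1, Fin.snoc x.1.2 x.2) : Params S K Θ × History S K N (h + 1)) := by fun_prop
  change ∫ x, f x ∂((M.run ρ N h ⊗ₘ M.round ρ N h).map _) = _
  exact integral_map hm.aemeasurable hf.aestronglyMeasurable

/-- The upper confidence bounds of the action taken and of the optimal action have the same
expectation. -/
lemma integral_upper_eq (M : Model S K Θ) (ρ : ArgmaxRule K) (β : ℝ) (n : Fin N) :
    ∫ z, upper β (z.2 n).1 (M.optimal ρ z.1.1 (z.2 n).1) z.1.2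
        ∂(M.run ρ N h ⊗ₘ M.round ρ N h) =
      ∫ z, upper β (z.2 n).1 (z.2 n).2.1 z.1.2 ∂(M.run ρ N h ⊗ₘ M.round ρ N h) := by
  have hU := (measurable_upper_apply (S := S) (K := K) (N := N) (h := h) β)
  have ho : Measurable fun q : (Params S K Θ × History S K N h) × Obs S K =>
      M.optimal ρ q.1.1 q.2.1 :=
    (M.measurable_optimal ρ).comp (measurable_fst.fst.prodMk measurable_snd.fst)
  have h1 : Measurable fun q : (Params S K Θ × History S K N h) × Obs S K =>
      upper β q.2.1 (M.optimal ρ q.1.1 q.2.1) q.1.2 :=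
    hU.comp (measurable_fst.snd.prodMk (measurable_snd.fst.prodMk ho))
  have h2 : Measurable fun q : (Params S K Θ × History S K N h) × Obs S K =>
      upper β q.2.1 q.2.2.1 q.1.2 :=
    hU.comp (measurable_fst.snd.prodMk (measurable_snd.fst.prodMk measurable_snd.snd.fst))
  -- Each coordinate of a round has the law of a single agent, so the identity for one agent applies
  -- to agent `n`.
  have key : ∀ f : (Params S K Θ × History S K N h) × Obs S K → ℝ, Measurable f →
      (∀ q, 0 ≤ f q) → ∫ z, f (z.1, z.2 n) ∂(M.run ρ N h ⊗ₘ M.round ρ N h) =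
        (∫⁻ x, ∫⁻ y, ENNReal.ofReal (f (x, y)) ∂(M.agent ρ N h x) ∂(M.run ρ N h)).toReal :=
    fun f hf h0 => by
      have hm : Measurable fun z : (Params S K Θ × History S K N h) × (Fin N → Obs S K) =>
          f (z.1, z.2 n) := hf.comp (by fun_prop)
      rw [integral_eq_lintegral_of_nonneg_ae (Filter.Eventually.of_forall fun z => h0 _)
        hm.aestronglyMeasurable, Measure.lintegral_compProd hm.ennreal_ofReal]
      congr 1
      refine lintegral_congr fun x => ?_
      have hx : Measurable fun y => ENNReal.ofReal (f (x, y)) :=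
        (hf.comp (measurable_const.prodMk measurable_id)).ennreal_ofReal
      exact (measurePreserving_eval (fun _ : Fin N => M.agent ρ N h x) n).lintegral_comp hx
  rw [key _ h1 fun q => upper_nonneg _ _ _ _, key _ h2 fun q => upper_nonneg _ _ _ _]
  congr 1
  have h3 := (M.lintegral_agent_eq_lintegral_optimal ρ hU.ennreal_ofReal).symm
  simpa only [optimal] using h3

/-- The regret of a round is at most the growth of the potential, up to failures of the confidence
bounds. -/
theorem integral_regret_succ_le (M : Model S K Θ) (hM : M.IsNormalized) (ρ : ArgmaxRule K)
    {β : ℝ} (hβ : 0 ≤ β) :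
    ∫ x, M.regret ρ x ∂(M.run ρ N (h + 1)) - ∫ x, totalPotential β x.2 ∂(M.run ρ N (h + 1)) ≤
      ∫ x, M.regret ρ x ∂(M.run ρ N h) - ∫ x, totalPotential β x.2 ∂(M.run ρ N h) +
        N * ∫ x, M.failures β x ∂(M.run ρ N h) := by
  let Q := M.run ρ N h ⊗ₘ M.round ρ N h
  have hfst : Q.map Prod.fst = M.run ρ N h := Measure.fst_compProd _ _
  have hmp : MeasurePreserving Prod.fst Q (M.run ρ N h) := ⟨measurable_fst, hfst⟩
  have hint : ∀ f : Params S K Θ × History S K N h → ℝ, Integrable f (M.run ρ N h) →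
      ∫ z, f z.1 ∂Q = ∫ x, f x ∂(M.run ρ N h) := fun f hf => by
    rw [← hfst, integral_map measurable_fst.aemeasurable (hfst ▸ hf.1)]
  have hR := M.integrable_regret (N := N) (h := h) hM ρ
  have hP := M.integrable_totalPotential (N := N) (h := h) ρ β
  have hF := M.integrable_failures (N := N) (h := h) ρ β
  have hRQ : Integrable (fun z => M.regret ρ z.1) Q := hmp.integrable_comp_of_integrable hR
  have hPQ : Integrable (fun z => totalPotential β z.1.2) Q :=
    hmp.integrable_comp_of_integrable hP
  have hFQ : Integrable (fun z => M.failures β z.1) Q := hmp.integrable_comp_of_integrable hF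
  have hsn : Measurable fun z : (Params S K Θ × History S K N h) × (Fin N → Obs S K) =>
      (Fin.snoc z.1.2 z.2 : History S K N (h + 1)) := by fun_prop
  have hPS : Integrable (fun z => totalPotential β
      (Fin.snoc z.1.2 z.2 : History S K N (h + 1))) Q := by
    refine Integrable.of_bound
      ((measurable_totalPotential β).comp hsn).aestronglyMeasurable
      (K * Fintype.card S * N +
        4 * Real.sqrt β * Real.sqrt (K * Fintype.card S * (N * (h + 1 : ℕ))))
      (Filter.Eventually.of_forall fun z => ?_)
    rw [Real.norm_of_nonneg (totalPotential_nonneg β _)]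
    exact totalPotential_le _
  have hgm : ∀ n, Measurable fun z : (Params S K Θ × History S K N h) × (Fin N → Obs S K) =>
      M.gap ρ z.1.1 (z.2 n) := fun n => by
    have hm : Measurable fun z : (Params S K Θ × History S K N h) × (Fin N → Obs S K) =>
      (z.1.1, z.2 n) := by fun_prop
    exact (M.measurable_gap ρ).comp hm
  have hG : ∀ n, Integrable (fun z => M.gap ρ z.1.1 (z.2 n)) Q := fun n =>
    Integrable.of_bound (hgm n).aestronglyMeasurable 1 (Filter.Eventually.of_forall fun z => by
      rw [Real.norm_of_nonneg (M.gap_nonneg ρ _ _)]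
      exact M.gap_le_one hM ρ _ _)
  have hU := (measurable_upper_apply (S := S) (K := K) (N := N) (h := h) β)
  have hUi : ∀ f : (Params S K Θ × History S K N h) × (Fin N → Obs S K) →
      History S K N h × S × Fin K, Measurable f →
      Integrable (fun z => upper β (f z).2.1 (f z).2.2 (f z).1) Q := fun f hf =>
    Integrable.of_bound (hU.comp hf).aestronglyMeasurable 1
      (Filter.Eventually.of_forall fun z => by
        rw [Real.norm_of_nonneg (upper_nonneg _ _ _ _)]
        exact upper_le_one _ _ _ _)
  have ho : ∀ n, Measurable fun z : (Params S K Θ × History S K N h) × (Fin N → Obs S K) =>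
      M.optimal ρ z.1.1 (z.2 n).1 := fun n => by
    have hm : Measurable fun z : (Params S K Θ × History S K N h) × (Fin N → Obs S K) =>
      (z.1.1, (z.2 n).1) := by fun_prop
    exact (M.measurable_optimal ρ).comp hm
  have hUo : ∀ n, Integrable (fun z => upper β (z.2 n).1 (M.optimal ρ z.1.1 (z.2 n).1) z.1.2) Q :=
    fun n => hUi (fun z => (z.1.2, (z.2 n).1, M.optimal ρ z.1.1 (z.2 n).1))
      (measurable_fst.snd.prodMk ((show Measurable fun z : (Params S K Θ × History S K N h) ×
        (Fin N → Obs S K) => (z.2 n).1 by fun_prop).prodMk (ho n)))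
  have hUa : ∀ n, Integrable (fun z => upper β (z.2 n).1 (z.2 n).2.1 z.1.2) Q :=
    fun n => hUi (fun z => (z.1.2, (z.2 n).1, (z.2 n).2.1)) (by fun_prop)
  have hD : ∀ n, Integrable (fun z => upper β (z.2 n).1 (M.optimal ρ z.1.1 (z.2 n).1) z.1.2 -
      upper β (z.2 n).1 (z.2 n).2.1 z.1.2) Q := fun n => (hUo n).sub (hUa n)
  -- The posterior sampling identity removes the middle terms of `gap_le`.
  have hD0 : ∫ z, ∑ n, (upper β (z.2 n).1 (M.optimal ρ z.1.1 (z.2 n).1) z.1.2 -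
      upper β (z.2 n).1 (z.2 n).2.1 z.1.2) ∂Q = 0 := by
    rw [integral_finsetSum _ fun n _ => hD n]
    refine Finset.sum_eq_zero fun n _ => ?_
    rw [integral_sub (hUo n) (hUa n), sub_eq_zero]
    exact M.integral_upper_eq ρ β n
  have hFN : Integrable (fun z => (N : ℝ) * M.failures β z.1) Q := hFQ.const_mul N
  have hDs : Integrable (fun z => ∑ n, (upper β (z.2 n).1 (M.optimal ρ z.1.1 (z.2 n).1) z.1.2 -
      upper β (z.2 n).1 (z.2 n).2.1 z.1.2)) Q := integrable_finsetSum _ fun n _ => hD n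
  have hFD : Integrable (fun z => (N : ℝ) * M.failures β z.1 +
      ∑ n, (upper β (z.2 n).1 (M.optimal ρ z.1.1 (z.2 n).1) z.1.2 -
        upper β (z.2 n).1 (z.2 n).2.1 z.1.2)) Q := hFN.add hDs
  have hPd : Integrable (fun z => totalPotential β (Fin.snoc z.1.2 z.2 : History S K N (h + 1)) -
      totalPotential β z.1.2) Q := hPS.sub hPQ
  have hstep : ∫ z, ∑ n, M.gap ρ z.1.1 (z.2 n) ∂Q ≤
      ∫ z, (N * M.failures β z.1 + ∑ n, (upper β (z.2 n).1 (M.optimal ρ z.1.1 (z.2 n).1) z.1.2 -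
        upper β (z.2 n).1 (z.2 n).2.1 z.1.2) +
        (totalPotential β (Fin.snoc z.1.2 z.2 : History S K N (h + 1)) -
          totalPotential β z.1.2)) ∂Q := by
    refine integral_mono (integrable_finsetSum _ fun n _ => hG n)
      (hFD.add hPd) fun z => ?_
    have h1 := Finset.sum_le_sum fun n (_ : n ∈ Finset.univ) => M.gap_le hM ρ β z.1 (z.2 n)
    simp only [Finset.sum_add_distrib, Finset.sum_const, Finset.card_univ, Fintype.card_fin,
      nsmul_eq_mul] at h1
    exact h1.trans (by gcongr; exact sum_width_le hβ z.1.2 z.2)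
  rw [integral_add hFD hPd, integral_add hFN hDs, integral_sub hPS hPQ, hD0, integral_const_mul,
    hint _ hF, hint _ hP] at hstep
  rw [integral_run_succ M ρ (M.measurable_regret ρ),
    integral_run_succ M ρ (f := fun x => totalPotential β x.2)
      ((measurable_totalPotential β).comp measurable_snd)]
  simp only [regret_snoc]
  change ∫ z, (M.regret ρ z.1 + _) ∂Q - ∫ z, _ ∂Q ≤ _
  rw [integral_add hRQ (integrable_finsetSum _ fun n _ => hG n), hint _ hR]
  linarith

/-- Regret minus potential grows in each round by at most `N` times the expected failures. Bounding
these with a fixed `T` above every `N * h` makes the increment uniform over the induction. -/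
theorem bayesRegret_le_potential (M : Model S K Θ) (hM : M.IsNormalized) (ρ : ArgmaxRule K)
    {β : ℝ} (hβ : 0 ≤ β) {T : ℕ} (hT : N * h ≤ T) :
    ∫ x, M.regret ρ x ∂(M.run ρ N h) - ∫ x, totalPotential β x.2 ∂(M.run ρ N h) ≤
      (N * h) * (2 * K * Fintype.card S * T * Real.exp (-(β / 2))) := by
  induction h with
  | zero =>
    have h0 : 0 ≤ ∫ x, totalPotential β x.2 ∂(M.run ρ N 0) :=
      integral_nonneg fun x => totalPotential_nonneg β x.2
    simpa [regret_eq_sum_gap] using h0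
  | succ h ih =>
    have hT' : N * h ≤ T := (Nat.mul_le_mul_left N h.le_succ).trans hT
    have h1 := M.integral_regret_succ_le (N := N) (h := h) hM ρ hβ
    have h2 : ∫ x, M.failures β x ∂(M.run ρ N h) ≤
        2 * K * Fintype.card S * T * Real.exp (-(β / 2)) := by
      refine (M.integral_failures_le hM ρ hβ).trans ?_
      gcongr
      exact_mod_cast hT'
    have h3 := mul_le_mul_of_nonneg_left h2 (Nat.cast_nonneg N : (0 : ℝ) ≤ N)
    have h4 := ih hT'
    push_cast
    linarith

/-- The Bayesian system regret, with a leading term that does not depend on the number of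
agents. -/
theorem bayesRegret_le (M : Model S K Θ) (hM : M.IsNormalized) (ρ : ArgmaxRule K)
    {H T : ℕ} (hN : 1 ≤ N) (hT : T = N * H) :
    M.bayesRegret ρ N H ≤ 2 * K * Fintype.card S * N +
      4 * Real.sqrt ((2 + 6 * Real.log T) * (K * Fintype.card S * T)) := by
  have hβ : 0 ≤ 2 + 6 * Real.log T := by
    have := Real.log_natCast_nonneg T
    linarith
  have h1 := M.bayesRegret_le_potential hM ρ hβ hT.ge
  have h2 : ∫ x, totalPotential (2 + 6 * Real.log T) x.2 ∂(M.run ρ N H) ≤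
      K * Fintype.card S * N + 4 * Real.sqrt (2 + 6 * Real.log T) *
        Real.sqrt (K * Fintype.card S * (N * H)) := by
    refine (integral_mono (M.integrable_totalPotential ρ _) (integrable_const _)
      fun x => totalPotential_le x.2).trans_eq ?_
    simp
  have hTr : (T : ℝ) = N * H := by exact_mod_cast hT
  -- Here exp(-β/2) = e⁻¹T⁻³, so the failures contribute (2/e)K|S|/T, which is below K|S|N; together
  -- with the first pulls this gives the 2 in 2K|S|N.
  have h3 : (T : ℝ) * (2 * K * Fintype.card S * T *
      Real.exp (-((2 + 6 * Real.log T) / 2))) ≤ K * Fintype.card S * N := by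
    rcases Nat.eq_zero_or_pos T with h0 | h0
    · simp only [h0, Nat.cast_zero, zero_mul]
      positivity
    have hTp : (1 : ℝ) ≤ T := by exact_mod_cast h0
    have he : Real.exp (-((2 + 6 * Real.log T) / 2)) = Real.exp (-1) * ((T : ℝ) ^ 3)⁻¹ := by
      rw [show -((2 + 6 * Real.log T) / 2) = -1 + -(3 * Real.log T) by ring, Real.exp_add,
        Real.exp_neg (3 * _), show 3 * Real.log T = ((3 : ℕ) : ℝ) * Real.log T by norm_num,
        Real.exp_nat_mul, Real.exp_log (by linarith)]
    have he1 : 2 * Real.exp (-1) ≤ 1 := by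
      rw [Real.exp_neg, ← div_eq_mul_inv, div_le_one (Real.exp_pos _)]
      linarith [Real.exp_one_gt_d9]
    rw [he, show (T : ℝ) * (2 * K * Fintype.card S * T * (Real.exp (-1) * ((T : ℝ) ^ 3)⁻¹)) =
      K * Fintype.card S * (2 * Real.exp (-1) * (T : ℝ)⁻¹) by field_simp]
    have hN' : (1 : ℝ) ≤ N := by exact_mod_cast hN
    have : 2 * Real.exp (-1) * (T : ℝ)⁻¹ ≤ 1 :=
      mul_le_one₀ he1 (by positivity) (inv_le_one_of_one_le₀ hTp)
    gcongr
    linarith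
  rw [← hTr] at h1 h2
  rw [Real.sqrt_mul hβ]
  unfold bayesRegret
  linarith

end Model

end ContextualBandit

end

/-! ### The two forms of the bound. -/

theorem theorem3 :
    (∀ (S : Type*) [Fintype S] [MeasurableSpace S] [MeasurableSingletonClass S]
      (K : ℕ) (Θ : Type*) [MeasurableSpace Θ] (M : ContextualBandit.Model S K Θ)
      (_ : M.IsNormalized) (ρ : ContextualBandit.ArgmaxRule K) (N H T : ℕ),
      1 ≤ K → 1 ≤ N → T = N * H →
        MeasureTheory.Integrable
          (fun x => M.regret ρ x) (M.run ρ N H) ∧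
        M.bayesRegret ρ N H ≤
          2 * K * Fintype.card S * N
            + 4 * Real.sqrt ((2 + 6 * Real.log T) * K * N * Fintype.card S * T)) ∧
    (∃ C : ℝ, 0 < C ∧
      ∀ (S : Type*) [Fintype S] [MeasurableSpace S] [MeasurableSingletonClass S] (K N : ℕ),
        1 ≤ K → 1 ≤ N → ∃ T₀ : ℕ,
          ∀ (Θ : Type*) [MeasurableSpace Θ] (M : ContextualBandit.Model S K Θ)
            (_ : M.IsNormalized) (ρ : ContextualBandit.ArgmaxRule K) (H T : ℕ),
            T = N * H → T₀ ≤ T →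
              M.bayesRegret ρ N H ≤ C * Real.sqrt (K * T * Fintype.card S * Real.log T)) := by
  refine ⟨fun S _ _ _ K Θ _ M hM ρ N H T hK hN hT => ⟨M.integrable_regret hM ρ, ?_⟩,
    -- 13 = 1 + 4 · 3: the delay term is at most one square root and the leading root at most three.
    -- The threshold contains (2K|S|N)²/(K|S|) for the delay term, and 3 > e to ensure log T ≥ 1.
    13, by norm_num, fun S _ _ _ K N hK hN => ⟨4 * K * Fintype.card S * N ^ 2 + 3,
      fun Θ _ M hM ρ H T hT hT₀ => ?_⟩⟩
  · refine (M.bayesRegret_le hM ρ hN hT).trans ?_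
    have hlog := Real.log_natCast_nonneg T
    have hN' : (1 : ℝ) ≤ N := by exact_mod_cast hN
    -- The extra `N` under the root is pure slack, from 1 ≤ N.
    gcongr 2 * K * Fintype.card S * N + 4 * Real.sqrt ?_
    calc (2 + 6 * Real.log T) * (K * Fintype.card S * T)
        = (2 + 6 * Real.log T) * K * 1 * Fintype.card S * T := by ring
      _ ≤ _ := by gcongr
  · refine (M.bayesRegret_le hM ρ hN hT).trans ?_
    have hT₁ : (4 * K * Fintype.card S * N ^ 2 + 3 : ℝ) ≤ T := by exact_mod_cast hT₀
    have hT₃ : (3 : ℝ) ≤ T := le_trans (le_add_of_nonneg_left (by positivity)) hT₁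
    have hlog : 1 ≤ Real.log T := by
      rw [Real.le_log_iff_exp_le (by linarith)]
      linarith [Real.exp_one_lt_d9]
    have hdelay : 2 * K * Fintype.card S * N ≤
        Real.sqrt (K * T * Fintype.card S * Real.log T) := by
      refine Real.le_sqrt_of_sq_le ?_
      calc (2 * K * Fintype.card S * N : ℝ) ^ 2
          = K * (4 * K * Fintype.card S * N ^ 2) * Fintype.card S * 1 := by ring
        _ ≤ _ := by gcongr; linarith
    have hlead : Real.sqrt ((2 + 6 * Real.log T) * (K * Fintype.card S * T)) ≤
        3 * Real.sqrt (K * T * Fintype.card S * Real.log T) := by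
      rw [← Real.sqrt_sq (by norm_num : (0 : ℝ) ≤ 3), ← Real.sqrt_mul (by norm_num)]
      refine Real.sqrt_le_sqrt ?_
      calc (2 + 6 * Real.log T) * (K * Fintype.card S * T)
          ≤ (3 ^ 2 * Real.log T) * (K * Fintype.card S * T) := by gcongr; linarith
        _ = _ := by ring
    linarith
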